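/- Let $P=\mathbb{R}_+^d$, let $\mathsf{k}$ be a separable complex Hilbert space (of finite or infinite dimension), and for a nonempty closed set $A\subseteq\mathbb{R}^d$ with $A+P\subseteq A$ let $S^A=\{S^A_x\}_{x\in P}$ be the isometric representation of $P$ on $L^2(A,\mathsf{k})$ (Lebesgue measure) by shifts: $(S^A_xf)(y)=f(y-x)$ if $y-x\in A$, and $0$ otherwise. For an isometric representation $V=\{V_x\}_{x\in P}$ on a Hilbert space $K$ (with $x\mapsto V_x$ and $x\mapsto V_x^*$ strongly continuous), an additive cocycle of $V$ is a continuous map $h:P\to K$ with $h_x\in\ker V_x^*$ and $h_{x+y}=h_x+V_xh_y$ for all $x,y\in P$. Let $\Gamma(K)$ be the symmetric Fock space with exponential vectors $e(u)=\sum_n u^{\otimes n}/\sqrt{n!}$, and for an isometry $W$ let $\Gamma(W)$ be its second quantization, $\Gamma(W)e(u)=e(Wu)$. The CCR flow $\alpha^V$ is the $E_0$-semigroup over $P$ on $B(\Gamma(K))$ given by $\alpha^V_x(T)=1_{\Gamma(\ker V_x^*)}\otimes\Gamma(V_x)T\Gamma(V_x)^*$, where $\Gamma(V_x)$ is regarded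 as a unitary onto $\Gamma(V_xK)$ and $\Gamma(K)$ is identified with $\Gamma(\ker V_x^*)\otimes\Gamma(V_xK)$. A unit of an $E_0$-semigroup $\alpha$ on $B(H)$ is a strongly continuous family $\{u_x\}_{x\in P}$ of bounded operators on $H$, not all zero, with $\alpha_x(T)u_x=u_xT$ and $u_{x+y}=u_xu_y$ for all $x,y\in P$, $T\in B(H)$; $\mathfrak{U}(\alpha)$ denotes the set of units. Say that $\alpha$ is of type II$_0$ if it has a unit $u$ such that every unit $v$ is of the form $v_x=c(x)u_x$ with scalars $c(x)$. (1) Let $d\ge 2$ and $A=\times_{i=1}^d\mathbb{R}_i$, where each $\mathbb{R}_i$ is $\mathbb{R}$ or $\mathbb{R}_+$ and at least one $\mathbb{R}_i$ is $\mathbb{R}_+$. Then the only additive cocycle of $S^A$ is $0$, $$\mathfrak{U}(\alpha^{S^A})=\bigl\{\{e^{\langle x,\mu\rangle}\Gamma(S^A_x)\}_{x\in P}:\mu\in\mathbb{C}^d\bigr\},\qquad \langle x,\mu\rangle=\sum_i x_i\mu_i,$$ and $\alpha^{S^A}$ is of type II$_0$. (2) Let $d=2$, $a<0<b$ and $A_T=A_T^{(a,b)}=[a,\infty)\times[b,\infty)\,\sqcup\,[0,\infty)\times[0,b)$.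 Then the only additive cocycle of $S^{A_T}$ is $0$, $$\mathfrak{U}(\alpha^{S^{A_T}})=\bigl\{\{e^{\langle x,\mu\rangle}\Gamma(S^{A_T}_x)\}_{x\in P}:\mu\in\mathbb{C}^2\bigr\},$$ and $\alpha^{S^{A_T}}$ is of type II$_0$. -/

import Mathlib

open scoped TensorProduct InnerProductSpace


noncomputable section

namespace CCR

universe u v w

/-! ### Isometries determined by their values on a total family -/

section Gram

variable {ι : Type*} {H : Type*} [NormedAddCommGroup H] [InnerProductSpace ℂ H]
  {H' : Type*} [NormedAddCommGroup H'] [InnerProductSpace ℂ H']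

/-- A family of vectors is total if its linear span is dense. -/
def IsTotal (a : ι → H) : Prop :=
  Dense (Submodule.span ℂ (Set.range a) : Set H)

theorem norm_linearCombination_eq {a : ι → H} {b : ι → H'}
    (h : ∀ i j, ⟪b i, b j⟫_ℂ = ⟪a i, a j⟫_ℂ) (f : ι →₀ ℂ) :
    ‖Finsupp.linearCombination ℂ b f‖ = ‖Finsupp.linearCombination ℂ a f‖ := by
  have key : ⟪Finsupp.linearCombination ℂ b f, Finsupp.linearCombination ℂ b f⟫_ℂ =
      ⟪Finsupp.linearCombination ℂ a f, Finsupp.linearCombination ℂ a f⟫_ℂ := by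
    simp only [Finsupp.linearCombination_apply, Finsupp.sum, sum_inner, inner_sum,
      inner_smul_left, inner_smul_right, h]
  rw [@norm_eq_sqrt_re_inner ℂ, @norm_eq_sqrt_re_inner ℂ, key]

theorem IsTotal.denseRange {a : ι → H} (ha : IsTotal a) :
    DenseRange (Finsupp.linearCombination ℂ a) := by
  have := ha
  rw [IsTotal, ← Finsupp.range_linearCombination] at this
  exact this

theorem IsTotal.ext {a : ι → H} (ha : IsTotal a) {E : Type*} [NormedAddCommGroup E]
    [NormedSpace ℂ E] {S T : H →L[ℂ] E} (h : ∀ i, S (a i) = T (a i)) : S = T := by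
  refine ContinuousLinearMap.ext_on ha ?_
  rintro _ ⟨i, rfl⟩
  exact h i

theorem IsTotal.ext_vec {a : ι → H} (ha : IsTotal a) {x y : H}
    (h : ∀ i, ⟪a i, x⟫_ℂ = ⟪a i, y⟫_ℂ) : x = y := by
  have h1 : x - y ∈ (Submodule.span ℂ (Set.range a))ᗮ := by
    rw [Submodule.mem_orthogonal]
    intro u hu
    induction hu using Submodule.span_induction with
    | mem _ hx => obtain ⟨i, rfl⟩ := hx; rw [inner_sub_right, h i, sub_self]
    | zero => exact inner_zero_left _
    | add u v _ _ hu hv => rw [inner_add_left, hu, hv, add_zero]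
    | smul c u _ hu => rw [inner_smul_left, hu, mul_zero]
  have h2 : ∀ z : H, ⟪z, x - y⟫_ℂ = 0 := by
    intro z
    have hcl : IsClosed {z : H | ⟪z, x - y⟫_ℂ = 0} :=
      isClosed_eq (continuous_id.inner continuous_const) continuous_const
    exact hcl.closure_subset_iff.2 (fun z hz => (Submodule.mem_orthogonal _ _).1 h1 z hz) (ha z)
  exact sub_eq_zero.1 (inner_self_eq_zero.1 (h2 (x - y)))

theorem IsTotal.ext_inner {a : ι → H} (ha : IsTotal a) {S T : H →L[ℂ] H}
    (h : ∀ i j, ⟪a i, S (a j)⟫_ℂ = ⟪a i, T (a j)⟫_ℂ) : S = T :=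
  ha.ext fun j => ha.ext_vec fun i => h i j

theorem isTotal_id : IsTotal (fun x : H => x) := by
  simp [IsTotal]

/-- Given a total family `a` and a family `b` with the same Gram matrix, the unique isometry
which maps `a i` to `b i`. -/
def gramIsometry [CompleteSpace H'] (a : ι → H) (b : ι → H') (ha : IsTotal a)
    (h : ∀ i j, ⟪b i, b j⟫_ℂ = ⟪a i, a j⟫_ℂ) : H →ₗᵢ[ℂ] H' where
  toLinearMap := ((Finsupp.linearCombination ℂ b).extendOfNorm
    (Finsupp.linearCombination ℂ a)).toLinearMap
  norm_map' := by
    refine ha.denseRange.induction ?_ (isClosed_eq ?_ continuous_norm)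
    · rintro _ ⟨f, rfl⟩
      rw [← norm_linearCombination_eq h f]
      congr 1
      exact LinearMap.extendOfNorm_eq ha.denseRange
        ⟨1, fun x => by rw [one_mul, norm_linearCombination_eq h]⟩ f
    · exact continuous_norm.comp (ContinuousLinearMap.continuous _)

theorem gramIsometry_apply [CompleteSpace H'] (a : ι → H) (b : ι → H') (ha : IsTotal a)
    (h : ∀ i j, ⟪b i, b j⟫_ℂ = ⟪a i, a j⟫_ℂ) (i : ι) :
    gramIsometry a b ha h (a i) = b i := by
  have := LinearMap.extendOfNorm_eq (f := Finsupp.linearCombination ℂ b) ha.denseRange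
        ⟨1, fun x => by rw [one_mul, norm_linearCombination_eq h]⟩ (Finsupp.single i 1)
  simp only [Finsupp.linearCombination_single, one_smul] at this
  exact this

/-- The unitary between Hilbert spaces which maps the total family `a` to the total family `b`
with the same Gram matrix. -/
def gramUnitary [CompleteSpace H] [CompleteSpace H'] (a : ι → H) (b : ι → H') (ha : IsTotal a)
    (hb : IsTotal b) (h : ∀ i j, ⟪b i, b j⟫_ℂ = ⟪a i, a j⟫_ℂ) : H ≃ₗᵢ[ℂ] H' :=
  LinearIsometryEquiv.ofSurjective (gramIsometry a b ha h) (by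
    intro y
    have hc : IsClosed (Set.range (gramIsometry a b ha h)) :=
      (gramIsometry a b ha h).isometry.isClosedEmbedding.isClosed_range
    have hs : (Submodule.span ℂ (Set.range b) : Set H') ⊆
        (LinearMap.range (gramIsometry a b ha h).toLinearMap : Set H') := by
      rw [SetLike.coe_subset_coe, Submodule.span_le]
      rintro _ ⟨i, rfl⟩
      exact ⟨a i, gramIsometry_apply a b ha h i⟩
    have := hc.closure_subset_iff.2 hs (hb y)
    simpa using this)

theorem gramUnitary_apply [CompleteSpace H] [CompleteSpace H'] (a : ι → H) (b : ι → H')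
    (ha : IsTotal a) (hb : IsTotal b) (h : ∀ i j, ⟪b i, b j⟫_ℂ = ⟪a i, a j⟫_ℂ) (i : ι) :
    gramUnitary a b ha hb h (a i) = b i :=
  gramIsometry_apply a b ha h i

end Gram

/-! ### The symmetric Fock space -/

/-- A complex inner product space, bundled. -/
structure InnerSpaceBundle : Type (u + 1) where
  carrier : Type u
  [normed : NormedAddCommGroup carrier]
  [inner : InnerProductSpace ℂ carrier]

attribute [instance] InnerSpaceBundle.normed InnerSpaceBundle.inner

section Fock

variable (K : Type u) [NormedAddCommGroup K] [InnerProductSpace ℂ K]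

/-- The `n`-fold Hilbert space tensor power of `K`: the `0`-th power is `ℂ`, and the `(n+1)`-st one
is the completion of the tensor product of `K` with the `n`-th one. -/
def tensorPowBundle : ℕ → InnerSpaceBundle.{u}
  | 0 => ⟨EuclideanSpace ℂ PUnit.{u + 1}⟩
  | n + 1 => ⟨UniformSpace.Completion (K ⊗[ℂ] (tensorPowBundle n).carrier)⟩

/-- The Hilbert space `K^{⊗ n}`. -/
def TensorPow (n : ℕ) : Type u := (tensorPowBundle K n).carrier

instance (n : ℕ) : NormedAddCommGroup (TensorPow K n) := (tensorPowBundle K n).normed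

instance (n : ℕ) : InnerProductSpace ℂ (TensorPow K n) := (tensorPowBundle K n).inner

instance : (n : ℕ) → CompleteSpace (TensorPow K n)
  | 0 => inferInstanceAs (CompleteSpace (EuclideanSpace ℂ PUnit.{u + 1}))
  | n + 1 => inferInstanceAs
      (CompleteSpace (UniformSpace.Completion (K ⊗[ℂ] (TensorPow K n))))

variable {K}

/-- The vector `u ⊗ ⋯ ⊗ u` (`n` factors). -/
def tensorPow (u : K) : (n : ℕ) → TensorPow K n
  | 0 => (EuclideanSpace.single PUnit.unit 1 : EuclideanSpace ℂ PUnit.{u + 1})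
  | n + 1 => ((u ⊗ₜ[ℂ] tensorPow u n : K ⊗[ℂ] (TensorPow K n)) :
      UniformSpace.Completion (K ⊗[ℂ] (TensorPow K n)))

theorem inner_tensorPow (u v : K) (n : ℕ) :
    ⟪tensorPow u n, tensorPow v n⟫_ℂ = ⟪u, v⟫_ℂ ^ n := by
  induction n with
  | zero =>
    change ⟪(EuclideanSpace.single PUnit.unit 1 : EuclideanSpace ℂ PUnit.{u + 1}),
      EuclideanSpace.single PUnit.unit 1⟫_ℂ = _
    simp
  | succ n ih =>
    change ⟪((u ⊗ₜ[ℂ] tensorPow u n : K ⊗[ℂ] (TensorPow K n)) :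
      UniformSpace.Completion (K ⊗[ℂ] (TensorPow K n))),
      ((v ⊗ₜ[ℂ] tensorPow v n : K ⊗[ℂ] (TensorPow K n)) :
      UniformSpace.Completion (K ⊗[ℂ] (TensorPow K n)))⟫_ℂ = _
    rw [UniformSpace.Completion.inner_coe, TensorProduct.inner_tmul, ih, pow_succ']

theorem tensorPow_smul (c : ℂ) (u : K) (n : ℕ) :
    tensorPow (c • u) n = c ^ n • tensorPow u n := by
  induction n with
  | zero => rw [pow_zero, one_smul]; rfl
  | succ n ih =>
    change ((((c • u) ⊗ₜ[ℂ] tensorPow (c • u) n : K ⊗[ℂ] (TensorPow K n))) :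
      UniformSpace.Completion (K ⊗[ℂ] (TensorPow K n))) =
      c ^ (n + 1) • ((u ⊗ₜ[ℂ] tensorPow u n : K ⊗[ℂ] (TensorPow K n)) :
      UniformSpace.Completion (K ⊗[ℂ] (TensorPow K n)))
    rw [ih, ← UniformSpace.Completion.coe_smul, TensorProduct.smul_tmul_smul, pow_succ']

variable (K) in
/-- The symmetric `n`-fold tensor power of `K`, the closed linear span of the vectors
`u ⊗ ⋯ ⊗ u` in `K^{⊗ n}`. -/
def SymPow (n : ℕ) : Submodule ℂ (TensorPow K n) :=
  (Submodule.span ℂ (Set.range fun u : K => tensorPow u n)).topologicalClosure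

instance (n : ℕ) : CompleteSpace (SymPow K n) :=
  (Submodule.isClosed_topologicalClosure _).completeSpace_coe

/-- The vector `u ⊗ ⋯ ⊗ u` as an element of the symmetric tensor power. -/
def symPow (u : K) (n : ℕ) : SymPow K n :=
  ⟨tensorPow u n, Submodule.le_topologicalClosure _ (Submodule.subset_span ⟨u, rfl⟩)⟩

variable (K) in
/-- The symmetric Fock space `Γ(K)`, the Hilbert space direct sum of the symmetric tensor powers
of `K`. -/
abbrev Fock : Type u := lp (fun n : ℕ => SymPow K n) 2

/-- The exponential vector `e(u) = ∑ₙ u^{⊗ n} / √n!`. -/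
def expVec (u : K) : Fock K :=
  ⟨fun n => ((Real.sqrt (n.factorial : ℝ))⁻¹ : ℂ) • symPow u n, by
    refine memℓp_gen ?_
    refine (NormedSpace.expSeries_div_summable (‖u‖ ^ 2)).congr fun n => ?_
    have h1 : ‖symPow u n‖ ^ 2 = (‖u‖ ^ 2) ^ n := by
      have := inner_tensorPow u u n
      rw [inner_self_eq_norm_sq_to_K, inner_self_eq_norm_sq_to_K] at this
      change ‖tensorPow u n‖ ^ 2 = _
      exact_mod_cast this
    rw [norm_smul]
    simp only [ENNReal.toReal_ofNat, Real.rpow_ofNat, mul_pow, h1]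
    simp [Real.sq_sqrt, div_eq_inv_mul]⟩

theorem inner_expVec (u v : K) : ⟪expVec u, expVec v⟫_ℂ = Complex.exp ⟪u, v⟫_ℂ := by
  rw [lp.inner_eq_tsum, Complex.exp_eq_exp_ℂ, NormedSpace.exp_eq_tsum_div]
  refine tsum_congr fun n => ?_
  change ⟪((Real.sqrt (n.factorial : ℝ))⁻¹ : ℂ) • tensorPow u n,
    ((Real.sqrt (n.factorial : ℝ))⁻¹ : ℂ) • tensorPow v n⟫_ℂ = _
  rw [inner_smul_left, inner_smul_right, inner_tensorPow, ← mul_assoc, div_eq_inv_mul]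
  congr 1
  rw [map_inv₀, Complex.conj_ofReal, ← mul_inv, ← Complex.ofReal_mul,
    Real.mul_self_sqrt (by positivity)]
  simp

theorem isTotal_expVec : IsTotal (expVec : K → Fock K) := by
  rw [IsTotal, Submodule.dense_iff_topologicalClosure_eq_top,
    Submodule.topologicalClosure_eq_top_iff, Submodule.eq_bot_iff]
  intro ξ hξ
  rw [Submodule.mem_orthogonal] at hξ
  have h0 : ∀ (u : K) (n : ℕ), ⟪symPow u n, ξ n⟫_ℂ = 0 := by
    intro u
    set c : ℕ → ℂ := fun n => ((Real.sqrt (n.factorial : ℝ))⁻¹ : ℂ) * ⟪ξ n, symPow u n⟫_ℂ with hc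
    have hsum : ∀ z : ℂ, HasSum (fun n => z ^ n * c n) 0 := by
      intro z
      have h1 := lp.hasSum_inner (𝕜 := ℂ) ξ (expVec (z • u))
      have h2 : ⟪ξ, expVec (z • u)⟫_ℂ = 0 := by
        rw [← inner_conj_symm, hξ _ (Submodule.subset_span ⟨_, rfl⟩), map_zero]
      rw [h2] at h1
      have h3 : (fun n => z ^ n * c n) = fun n => ⟪ξ n, expVec (z • u) n⟫_ℂ := by
        funext n
        have : (expVec (z • u) : ∀ n, SymPow K n) n =
            ((Real.sqrt (n.factorial : ℝ))⁻¹ : ℂ) • z ^ n • symPow u n := by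
          apply Subtype.ext
          change ((Real.sqrt (n.factorial : ℝ))⁻¹ : ℂ) • tensorPow (z • u) n =
            ((Real.sqrt (n.factorial : ℝ))⁻¹ : ℂ) • z ^ n • tensorPow u n
          rw [tensorPow_smul]
        rw [this, inner_smul_right, inner_smul_right]
        simp only [hc]
        ring
      rw [h3]
      exact h1
    have hp : HasFPowerSeriesAt (0 : ℂ → ℂ) (FormalMultilinearSeries.ofScalars ℂ c) 0 := by
      rw [hasFPowerSeriesAt_iff]
      refine Filter.Eventually.of_forall fun z => ?_
      simpa using hsum z
    have hc0 := hp.eq_zero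
    intro n
    have h3 : c n = 0 := by
      have := FormalMultilinearSeries.coeff_ofScalars (𝕜 := ℂ) (p := c) (n := n)
      rw [hc0] at this
      exact this.symm
    have h4 : ((Real.sqrt (n.factorial : ℝ))⁻¹ : ℂ) ≠ 0 := by
      rw [← Complex.ofReal_inv, Complex.ofReal_ne_zero]
      have := Real.sqrt_pos.2 (Nat.cast_pos (α := ℝ).2 n.factorial_pos)
      positivity
    rw [← inner_conj_symm, (mul_eq_zero.1 h3).resolve_left h4, map_zero]
  apply lp.ext
  funext n
  have h5 : (ξ n : TensorPow K n) ∈ SymPow K n := (ξ n).2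
  have h6 : SymPow K n ≤ (Submodule.span ℂ {(ξ n : TensorPow K n)})ᗮ := by
    refine Submodule.topologicalClosure_minimal _ ?_ (Submodule.isClosed_orthogonal _)
    rw [Submodule.span_le]
    rintro _ ⟨u, rfl⟩
    rw [SetLike.mem_coe, Submodule.mem_orthogonal_singleton_iff_inner_left]
    exact h0 u n
  have h7 := Submodule.mem_orthogonal_singleton_iff_inner_left.1 (h6 h5)
  exact Subtype.ext (inner_self_eq_zero.1 h7)

end Fock


section Ops

open UniformSpace ContinuousLinearMap Filter Topology

theorem continuous_expVec {K : Type u} [NormedAddCommGroup K] [InnerProductSpace ℂ K] :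
    Continuous (expVec : K → Fock K) := by
  rw [continuous_iff_continuousAt]
  intro u
  rw [ContinuousAt, tendsto_iff_norm_sub_tendsto_zero]
  have h1 : ∀ v : K, ‖expVec v - expVec u‖ =
      Real.sqrt (RCLike.re (Complex.exp ⟪v, v⟫_ℂ - Complex.exp ⟪v, u⟫_ℂ - Complex.exp ⟪u, v⟫_ℂ
        + Complex.exp ⟪u, u⟫_ℂ)) := by
    intro v
    rw [@norm_eq_sqrt_re_inner ℂ, inner_sub_sub_self]
    simp only [inner_expVec]
  simp only [h1]
  have h2 : Continuous fun v : K =>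
      Real.sqrt (RCLike.re (Complex.exp ⟪v, v⟫_ℂ - Complex.exp ⟪v, u⟫_ℂ - Complex.exp ⟪u, v⟫_ℂ
        + Complex.exp ⟪u, u⟫_ℂ)) := by
    refine Real.continuous_sqrt.comp (RCLike.continuous_re.comp ?_)
    fun_prop
  have h3 := h2.tendsto u
  simpa using h3

/-- The second quantization `Γ(V)` of an isometry, the unique isometry with `Γ(V) e(v) = e(V v)`. -/
def secondQuant {K : Type u} [NormedAddCommGroup K] [InnerProductSpace ℂ K]
    {K' : Type v} [NormedAddCommGroup K'] [InnerProductSpace ℂ K'] (V : K →ₗᵢ[ℂ] K') :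
    Fock K →ₗᵢ[ℂ] Fock K' :=
  gramIsometry expVec (fun v => expVec (V v)) isTotal_expVec (fun u v => by
    rw [inner_expVec, inner_expVec, V.inner_map_map])

theorem secondQuant_expVec {K : Type u} [NormedAddCommGroup K] [InnerProductSpace ℂ K]
    {K' : Type v} [NormedAddCommGroup K'] [InnerProductSpace ℂ K'] (V : K →ₗᵢ[ℂ] K') (v : K) :
    secondQuant V (expVec v) = expVec (V v) :=
  gramIsometry_apply _ _ _ _ v

/-! ### Hilbert space tensor products -/

section HTensor

variable (E : Type u) [NormedAddCommGroup E] [InnerProductSpace ℂ E]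
  {F : Type v} [NormedAddCommGroup F] [InnerProductSpace ℂ F]

variable (F) in
/-- The Hilbert space tensor product, the completion of the algebraic one. -/
abbrev HTensor : Type (max u v) := Completion (E ⊗[ℂ] F)

variable {E} in
/-- The elementary tensor `x ⊗ y` in the Hilbert space tensor product. -/
def htmul (x : E) (y : F) : HTensor E F := ((x ⊗ₜ[ℂ] y : E ⊗[ℂ] F) : Completion (E ⊗[ℂ] F))

variable {E} in
theorem inner_htmul (x x' : E) (y y' : F) :
    ⟪htmul x y, htmul x' y'⟫_ℂ = ⟪x, x'⟫_ℂ * ⟪y, y'⟫_ℂ := by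
  rw [htmul, htmul, Completion.inner_coe, TensorProduct.inner_tmul]

variable {E} in
theorem isTotal_htmul {ι κ : Type*} {a : ι → E} {b : κ → F} (ha : IsTotal a) (hb : IsTotal b) :
    IsTotal (fun p : ι × κ => htmul (a p.1) (b p.2)) := by
  have hcont : Continuous fun p : E × F => htmul p.1 p.2 :=
    (Completion.continuous_coe _).comp TensorProduct.continuous_tmul
  set M := (Submodule.span ℂ (Set.range fun p : ι × κ => htmul (a p.1) (b p.2))).topologicalClosure
    with hM
  have hMc : IsClosed (M : Set (HTensor E F)) := Submodule.isClosed_topologicalClosure _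
  have h1 : ∀ (i : ι) (y : F), htmul (a i) y ∈ M := by
    intro i y
    have hle : Submodule.span ℂ (Set.range b) ≤
        M.comap ((Completion.toComplL (𝕜 := ℂ) (E := E ⊗[ℂ] F)).toLinearMap ∘ₗ
          TensorProduct.mk ℂ E F (a i)) := by
      rw [Submodule.span_le]
      rintro _ ⟨j, rfl⟩
      exact Submodule.le_topologicalClosure _ (Submodule.subset_span ⟨(i, j), rfl⟩)
    have hcl : IsClosed {y : F | htmul (a i) y ∈ M} :=
      hMc.preimage (hcont.comp (Continuous.prodMk continuous_const continuous_id))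
    exact hcl.closure_subset_iff.2 (fun z hz => hle hz) (hb y)
  have h2 : ∀ (x : E) (y : F), htmul x y ∈ M := by
    intro x y
    have hle : Submodule.span ℂ (Set.range a) ≤
        M.comap ((Completion.toComplL (𝕜 := ℂ) (E := E ⊗[ℂ] F)).toLinearMap ∘ₗ
          (TensorProduct.mk ℂ E F).flip y) := by
      rw [Submodule.span_le]
      rintro _ ⟨i, rfl⟩
      exact h1 i y
    have hcl : IsClosed {x : E | htmul x y ∈ M} :=
      hMc.preimage (hcont.comp (Continuous.prodMk continuous_id continuous_const))
    exact hcl.closure_subset_iff.2 (fun z hz => hle hz) (ha x)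
  have h3 : ∀ z : E ⊗[ℂ] F, (z : Completion (E ⊗[ℂ] F)) ∈ M := by
    intro z
    induction z using TensorProduct.induction_on with
    | zero => rw [Completion.coe_zero]; exact M.zero_mem
    | tmul x y => exact h2 x y
    | add z w hz hw => rw [Completion.coe_add]; exact M.add_mem hz hw
  rw [IsTotal, Submodule.dense_iff_topologicalClosure_eq_top, ← hM, Submodule.eq_top_iff']
  intro z
  induction z using Completion.induction_on with
  | hp => exact hMc
  | ih z => exact h3 z

variable {E} in
theorem HTensor.ext {G : Type*} [NormedAddCommGroup G] [NormedSpace ℂ G]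
    {S T : HTensor E F →L[ℂ] G} (h : ∀ x y, S (htmul x y) = T (htmul x y)) : S = T := by
  refine (isTotal_htmul isTotal_id isTotal_id).ext ?_
  rintro ⟨x, y⟩
  exact h x y

/-- The operator `1 ⊗ T` on the Hilbert space tensor product. -/
def idTensor (T : F →L[ℂ] F) : HTensor E F →L[ℂ] HTensor E F := (T.lTensor E).completion

theorem idTensor_htmul (T : F →L[ℂ] F) (x : E) (y : F) :
    idTensor E T (htmul x y) = htmul x (T y) := by
  rw [idTensor, htmul, completion_apply_coe]
  rfl

/-- The unital `*`-homomorphism `T ↦ 1 ⊗ T`. -/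
def idTensorHom [CompleteSpace F] :
    (F →L[ℂ] F) →⋆ₐ[ℂ] (HTensor E F →L[ℂ] HTensor E F) where
  toFun := idTensor E
  map_one' := HTensor.ext fun x y => by rw [idTensor_htmul]; rfl
  map_mul' S T := HTensor.ext fun x y => by
    rw [mul_apply_eq_comp, idTensor_htmul, idTensor_htmul, idTensor_htmul]; rfl
  map_zero' := HTensor.ext fun x y => by
    rw [idTensor_htmul]; simp [htmul]
  map_add' S T := HTensor.ext fun x y => by
    rw [add_apply, idTensor_htmul, idTensor_htmul, idTensor_htmul]
    simp [htmul, TensorProduct.tmul_add, Completion.coe_add]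
  commutes' c := HTensor.ext fun x y => by
    rw [idTensor_htmul]
    simp [htmul, Algebra.algebraMap_eq_smul_one]
  map_star' T := by
    refine (isTotal_htmul isTotal_id isTotal_id).ext_inner ?_
    rintro ⟨x, y⟩ ⟨x', y'⟩
    rw [star_eq_adjoint, star_eq_adjoint, adjoint_inner_right, idTensor_htmul, idTensor_htmul,
      inner_htmul, inner_htmul, adjoint_inner_right]

end HTensor


/-! ### Convergence of matrix coefficients -/

section Coefficients

variable {X ι : Type*} {H : Type*} [NormedAddCommGroup H] [InnerProductSpace ℂ H]

theorem IsTotal.tendsto_right {a : ι → H} (ha : IsTotal a) {l : Filter X} {f : X → H} {f₀ : H}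
    {C : ℝ} (hf : ∀ᶠ x in l, ‖f x‖ ≤ C)
    (h : ∀ i, Tendsto (fun x => ⟪f x, a i⟫_ℂ) l (𝓝 ⟪f₀, a i⟫_ℂ)) (η : H) :
    Tendsto (fun x => ⟪f x, η⟫_ℂ) l (𝓝 ⟪f₀, η⟫_ℂ) := by
  have hspan : ∀ η ∈ Submodule.span ℂ (Set.range a),
      Tendsto (fun x => ⟪f x, η⟫_ℂ) l (𝓝 ⟪f₀, η⟫_ℂ) := by
    intro η hη
    induction hη using Submodule.span_induction with
    | mem _ hx => obtain ⟨i, rfl⟩ := hx; exact h i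
    | zero => simpa only [inner_zero_right] using tendsto_const_nhds
    | add u v _ _ hu hv => simpa only [inner_add_right] using hu.add hv
    | smul c u _ hu => simpa only [inner_smul_right] using hu.const_mul c
  rw [Metric.tendsto_nhds]
  intro ε hε
  have hC : 0 < |C| + ‖f₀‖ + 1 := by positivity
  obtain ⟨η', hη', hd⟩ := Metric.mem_closure_iff.1 (ha η) (ε / 2 / (|C| + ‖f₀‖ + 1))
    (by positivity)
  filter_upwards [hf, (Metric.tendsto_nhds.1 (hspan η' hη')) (ε / 2) (by positivity)] with x hx hx'
  rw [dist_eq_norm] at hx' hd ⊢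
  have e1 : ⟪f x, η⟫_ℂ - ⟪f₀, η⟫_ℂ = ⟪f x - f₀, η - η'⟫_ℂ + (⟪f x, η'⟫_ℂ - ⟪f₀, η'⟫_ℂ) := by
    simp only [inner_sub_left, inner_sub_right]; ring
  have e2 : ‖⟪f x - f₀, η - η'⟫_ℂ‖ ≤ ε / 2 := by
    refine (norm_inner_le_norm _ _).trans ?_
    have e3 : ‖f x - f₀‖ ≤ |C| + ‖f₀‖ + 1 := by
      have := norm_sub_le (f x) f₀
      have := le_abs_self C
      linarith
    calc ‖f x - f₀‖ * ‖η - η'‖ ≤ (|C| + ‖f₀‖ + 1) * (ε / 2 / (|C| + ‖f₀‖ + 1)) := by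
          gcongr
      _ = ε / 2 := by field_simp
  rw [e1]
  have := norm_add_le ⟪f x - f₀, η - η'⟫_ℂ (⟪f x, η'⟫_ℂ - ⟪f₀, η'⟫_ℂ)
  linarith

theorem IsTotal.tendsto_inner [CompleteSpace H] {a : ι → H} (ha : IsTotal a) {l : Filter X}
    {S : X → H →L[ℂ] H} {S₀ : H →L[ℂ] H} {C : ℝ} (hS : ∀ᶠ x in l, ‖S x‖ ≤ C)
    (h : ∀ i j, Tendsto (fun x => ⟪a i, S x (a j)⟫_ℂ) l (𝓝 ⟪a i, S₀ (a j)⟫_ℂ)) (ξ η : H) :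
    Tendsto (fun x => ⟪ξ, S x η⟫_ℂ) l (𝓝 ⟪ξ, S₀ η⟫_ℂ) := by
  have h1 : ∀ i, Tendsto (fun x => ⟪a i, S x η⟫_ℂ) l (𝓝 ⟪a i, S₀ η⟫_ℂ) := by
    intro i
    simp only [← adjoint_inner_left]
    refine ha.tendsto_right (C := C * ‖a i‖) ?_ ?_ η
    · filter_upwards [hS] with x hx
      refine (le_opNorm _ _).trans ?_
      rw [LinearIsometryEquiv.norm_map]
      gcongr
    · intro j
      simpa only [adjoint_inner_left] using h i j
  have h2 : Tendsto (fun x => ⟪S x η, ξ⟫_ℂ) l (𝓝 ⟪S₀ η, ξ⟫_ℂ) := by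
    refine ha.tendsto_right (C := C * ‖η‖) ?_ ?_ ξ
    · filter_upwards [hS] with x hx
      refine (le_opNorm _ _).trans ?_
      gcongr
    · intro i
      have := (Complex.continuous_conj.tendsto _).comp (h1 i)
      simpa only [Function.comp_def, inner_conj_symm] using this
  have := (Complex.continuous_conj.tendsto _).comp h2
  simpa only [Function.comp_def, inner_conj_symm] using this

end Coefficients

/-! ### `E₀`-semigroups and units -/

section E0

variable {P : Type*} [AddCommMonoid P] [TopologicalSpace P]
  {H : Type*} [NormedAddCommGroup H] [InnerProductSpace ℂ H] [CompleteSpace H]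

/-- A map on `B(H)` is normal if it is continuous on bounded sets for the weak operator topology
(equivalently, for linear maps, continuous for the `σ`-weak topology): bounded nets which converge
weakly are mapped to weakly convergent nets. -/
def IsNormalMap (φ : (H →L[ℂ] H) → (H →L[ℂ] H)) : Prop :=
  ∀ (l : Filter (H →L[ℂ] H)) (C : ℝ) (T : H →L[ℂ] H), (∀ᶠ S in l, ‖S‖ ≤ C) →
    (∀ ξ η : H, Tendsto (fun S : H →L[ℂ] H => ⟪ξ, S η⟫_ℂ) l (𝓝 ⟪ξ, T η⟫_ℂ)) →
    ∀ ξ η : H, Tendsto (fun S : H →L[ℂ] H => ⟪ξ, φ S η⟫_ℂ) l (𝓝 ⟪ξ, φ T η⟫_ℂ)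

variable (P H) in
/-- An `E₀`-semigroup over `P` on `B(H)`: a weakly continuous semigroup, indexed by `P`, of normal
unital `*`-endomorphisms of `B(H)`. -/
structure E0Semigroup where
  toFun : P → (H →L[ℂ] H) →⋆ₐ[ℂ] (H →L[ℂ] H)
  normal : ∀ x, IsNormalMap (toFun x)
  map_zero : ∀ T, toFun 0 T = T
  map_add : ∀ x y T, toFun (x + y) T = toFun x (toFun y T)
  continuous : ∀ (T : H →L[ℂ] H) (ξ η : H), Continuous fun x => ⟪toFun x T ξ, η⟫_ℂ

/-- A unit of an `E₀`-semigroup `α`: a strongly continuous semigroup of operators `u x`, not all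
zero, which intertwine: `α_x(T) u_x = u_x T`. -/
structure IsUnitOf (α : E0Semigroup P H) (u : P → H →L[ℂ] H) : Prop where
  continuous : ∀ ξ : H, Continuous fun x => u x ξ
  intertwine : ∀ (x : P) (T : H →L[ℂ] H), α.toFun x T ∘L u x = u x ∘L T
  map_add : ∀ x y : P, u (x + y) = u x ∘L u y
  exists_ne_zero : ∃ x : P, u x ≠ 0

/-- The set of all units of an `E₀`-semigroup. -/
def unitSet (α : E0Semigroup P H) : Set (P → H →L[ℂ] H) := {u | IsUnitOf α u}

/-- An `E₀`-semigroup is of type II₀ if it admits a unit and only one unit up to scalars. -/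
def IsTypeII0 (α : E0Semigroup P H) : Prop :=
  ∃ u ∈ unitSet α, ∀ v ∈ unitSet α, ∃ c : P → ℂ, ∀ x, v x = c x • u x

end E0

/-! ### Isometric representations, additive cocycles and CCR flows -/

section CCRFlow

variable {P : Type*} [AddCommMonoid P] [TopologicalSpace P]
  {K : Type u} [NormedAddCommGroup K] [InnerProductSpace ℂ K] [CompleteSpace K]

variable (P K) in
/-- A strictly continuous isometric representation of `P` on `K`. -/
structure IsometricRep where
  toFun : P → K →ₗᵢ[ℂ] K
  map_add : ∀ x y ξ, toFun (x + y) ξ = toFun x (toFun y ξ)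
  continuous : ∀ ξ : K, Continuous fun x => toFun x ξ
  continuous_adjoint : ∀ ξ : K, Continuous fun x => adjoint (toFun x).toContinuousLinearMap ξ

theorem IsometricRep.map_zero (V : IsometricRep P K) (ξ : K) : V.toFun 0 ξ = ξ := by
  apply (V.toFun 0).injective
  rw [← V.map_add, add_zero]

/-- An additive cocycle of an isometric representation `V`: a continuous function `h : P → K` with
`h_x ∈ ker V_x^*` and `h_{x+y} = h_x + V_x h_y`. -/
structure IsAdditiveCocycle (V : IsometricRep P K) (h : P → K) : Prop where
  continuous : Continuous h
  mem_ker : ∀ x, adjoint (V.toFun x).toContinuousLinearMap (h x) = 0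
  map_add : ∀ x y, h (x + y) = h x + V.toFun x (h y)

/-- The subspace `ker V^*`. -/
def kerAdjoint (V : K →ₗᵢ[ℂ] K) : Submodule ℂ K :=
  LinearMap.ker (adjoint V.toContinuousLinearMap).toLinearMap

theorem adjoint_apply_self (V : K →ₗᵢ[ℂ] K) (ξ : K) :
    adjoint V.toContinuousLinearMap (V ξ) = ξ := by
  refine ext_inner_left ℂ fun η => ?_
  rw [adjoint_inner_right]
  exact V.inner_map_map _ _

theorem adjoint_apply_ker (V : K →ₗᵢ[ℂ] K) (w : kerAdjoint V) :
    adjoint V.toContinuousLinearMap (w : K) = 0 := w.2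

theorem inner_ker_add (V : K →ₗᵢ[ℂ] K) (w w' : kerAdjoint V) (v v' : K) :
    ⟪(w : K) + V v, (w' : K) + V v'⟫_ℂ = ⟪w, w'⟫_ℂ + ⟪v, v'⟫_ℂ := by
  have h1 : ∀ (w : kerAdjoint V) (v : K), ⟪(w : K), V v⟫_ℂ = 0 := by
    intro w v
    have := adjoint_inner_left V.toContinuousLinearMap v (w : K)
    rw [adjoint_apply_ker, inner_zero_left] at this
    exact this.symm
  have h2 : ∀ (w : kerAdjoint V) (v : K), ⟪V v, (w : K)⟫_ℂ = 0 := by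
    intro w v
    rw [← inner_conj_symm, h1, _root_.map_zero]
  rw [inner_add_left, inner_add_right, inner_add_right, h1, h2, V.inner_map_map,
    Submodule.coe_inner]
  ring

theorem exists_ker_add (V : K →ₗᵢ[ℂ] K) (u : K) :
    ∃ w : kerAdjoint V, (w : K) + V (adjoint V.toContinuousLinearMap u) = u := by
  refine ⟨⟨u - V (adjoint V.toContinuousLinearMap u), ?_⟩, by simp⟩
  change adjoint V.toContinuousLinearMap (u - V (adjoint V.toContinuousLinearMap u)) = 0
  rw [map_sub, adjoint_apply_self, sub_self]

/-- The unitary `Γ(ker V^*) ⊗ Γ(K) → Γ(K)` which maps `e(w) ⊗ e(v)` to `e(w + V v)`, that is,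
`1 ⊗ Γ(V)` followed by the identification of `Γ(ker V^*) ⊗ Γ(V K)` with `Γ(K)`. -/
def fockSplit (V : K →ₗᵢ[ℂ] K) : HTensor (Fock (kerAdjoint V)) (Fock K) ≃ₗᵢ[ℂ] Fock K :=
  gramUnitary (fun p : kerAdjoint V × K => htmul (expVec p.1) (expVec p.2))
    (fun p => expVec ((p.1 : K) + V p.2))
    (isTotal_htmul isTotal_expVec isTotal_expVec)
    (by
      have h : Set.range (fun p : kerAdjoint V × K => expVec ((p.1 : K) + V p.2)) =
          Set.range (expVec : K → Fock K) := by
        refine Set.Subset.antisymm ?_ ?_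
        · rintro _ ⟨p, rfl⟩
          exact ⟨_, rfl⟩
        · rintro _ ⟨u, rfl⟩
          obtain ⟨w, hw⟩ := exists_ker_add V u
          exact ⟨(w, adjoint V.toContinuousLinearMap u), by simp only [hw]⟩
      have := isTotal_expVec (K := K)
      rw [IsTotal, ← h] at this
      exact this)
    (by
      rintro ⟨w, v⟩ ⟨w', v'⟩
      rw [inner_expVec, inner_htmul, inner_expVec, inner_expVec, inner_ker_add, Complex.exp_add])

theorem fockSplit_htmul (V : K →ₗᵢ[ℂ] K) (w : kerAdjoint V) (v : K) :
    fockSplit V (htmul (expVec w) (expVec v)) = expVec ((w : K) + V v) :=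
  gramUnitary_apply _ _ _ _ _ (w, v)

/-- The unital `*`-endomorphism `T ↦ 1_{Γ(ker V^*)} ⊗ Γ(V) T Γ(V)^*` of `B(Γ(K))`, where `Γ(V)` is
considered as a unitary from `Γ(K)` to `Γ(V K)`. -/
def ccrEndo (V : K →ₗᵢ[ℂ] K) : (Fock K →L[ℂ] Fock K) →⋆ₐ[ℂ] (Fock K →L[ℂ] Fock K) :=
  (fockSplit V).conjStarAlgEquiv.toStarAlgHom.comp (idTensorHom (Fock (kerAdjoint V)))

theorem ccrEndo_apply_fockSplit (V : K →ₗᵢ[ℂ] K) (T : Fock K →L[ℂ] Fock K)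
    (z : HTensor (Fock (kerAdjoint V)) (Fock K)) :
    ccrEndo V T (fockSplit V z) = fockSplit V (idTensor _ T z) := by
  change fockSplit V (idTensor _ T ((fockSplit V).symm (fockSplit V z))) = _
  rw [LinearIsometryEquiv.symm_apply_apply]

theorem inner_ccrEndo (V : K →ₗᵢ[ℂ] K) (T : Fock K →L[ℂ] Fock K) (u v : K) :
    ⟪expVec u, ccrEndo V T (expVec v)⟫_ℂ =
      Complex.exp (⟪u, v⟫_ℂ - ⟪adjoint V.toContinuousLinearMap u, adjoint V.toContinuousLinearMap v⟫_ℂ) *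
        ⟪expVec (adjoint V.toContinuousLinearMap u), T (expVec (adjoint V.toContinuousLinearMap v))⟫_ℂ := by
  obtain ⟨w, hw⟩ := exists_ker_add V u
  obtain ⟨w', hw'⟩ := exists_ker_add V v
  have h1 : ⟪u, v⟫_ℂ - ⟪adjoint V.toContinuousLinearMap u, adjoint V.toContinuousLinearMap v⟫_ℂ =
      ⟪w, w'⟫_ℂ := by
    have := inner_ker_add V w w' (adjoint V.toContinuousLinearMap u) (adjoint V.toContinuousLinearMap v)
    rw [hw, hw'] at this
    rw [this]; ring
  rw [h1]
  conv_lhs => rw [← hw, ← hw']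
  rw [← fockSplit_htmul, ← fockSplit_htmul, ccrEndo_apply_fockSplit,
    LinearIsometryEquiv.inner_map_map, idTensor_htmul, inner_htmul, inner_expVec]

/-- The CCR flow `α^V` on `B(Γ(K))` associated with an isometric representation `V` on `K`. -/
def ccrFlow (V : IsometricRep P K) : E0Semigroup P (Fock K) where
  toFun x := ccrEndo (V.toFun x)
  normal x := by
    intro l C T hl hT
    refine isTotal_expVec.tendsto_inner (C := C) ?_ ?_
    · filter_upwards [hl] with S hS
      exact (NonUnitalStarAlgHom.norm_apply_le _ S).trans hS
    · intro u v
      simp only [inner_ccrEndo]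
      exact (hT _ _).const_mul _
  map_zero T := by
    refine isTotal_expVec.ext_inner fun u v => ?_
    have h : ∀ u, adjoint (V.toFun 0).toContinuousLinearMap u = u := by
      intro u
      have := adjoint_apply_self (V.toFun 0) u
      rwa [V.map_zero] at this
    rw [inner_ccrEndo, h, h, sub_self, Complex.exp_zero, one_mul]
  map_add x y T := by
    refine isTotal_expVec.ext_inner fun u v => ?_
    have h : ∀ u, adjoint (V.toFun (x + y)).toContinuousLinearMap u =
        adjoint (V.toFun y).toContinuousLinearMap (adjoint (V.toFun x).toContinuousLinearMap u) := by
      intro u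
      refine ext_inner_left ℂ fun η => ?_
      rw [adjoint_inner_right, adjoint_inner_right, adjoint_inner_right]
      exact congrArg (fun z => ⟪z, u⟫_ℂ) (V.map_add x y η)
    rw [inner_ccrEndo, inner_ccrEndo, inner_ccrEndo, h, h, ← mul_assoc, ← Complex.exp_add]
    congr 2
    ring
  continuous T ξ η := by
    rw [continuous_iff_continuousAt]
    intro x₀
    have key : ∀ ξ η : Fock K, Tendsto (fun x => ⟪ξ, ccrEndo (V.toFun x) T η⟫_ℂ) (𝓝 x₀)
        (𝓝 ⟪ξ, ccrEndo (V.toFun x₀) T η⟫_ℂ) := by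
      refine isTotal_expVec.tendsto_inner (C := ‖T‖) ?_ ?_
      · exact Eventually.of_forall fun x => NonUnitalStarAlgHom.norm_apply_le _ T
      · intro u v
        simp only [inner_ccrEndo]
        have hu := V.continuous_adjoint u
        have hv := V.continuous_adjoint v
        have hc : Continuous fun x =>
            Complex.exp (⟪u, v⟫_ℂ - ⟪adjoint (V.toFun x).toContinuousLinearMap u,
              adjoint (V.toFun x).toContinuousLinearMap v⟫_ℂ) *
            ⟪expVec (adjoint (V.toFun x).toContinuousLinearMap u),
              T (expVec (adjoint (V.toFun x).toContinuousLinearMap v))⟫_ℂ := by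
          refine (Complex.continuous_exp.comp (continuous_const.sub (hu.inner hv))).mul ?_
          exact (continuous_expVec.comp hu).inner (T.continuous.comp (continuous_expVec.comp hv))
        exact hc.tendsto x₀
    have := (Complex.continuous_conj.tendsto _).comp (key η ξ)
    simpa only [ContinuousAt, Function.comp_def, inner_conj_symm] using this

end CCRFlow

end Ops

/-! ### Shifts on `P`-modules, for `P = ℝ₊ᵈ` -/

section Shift

open MeasureTheory Filter Topology
open scoped NNReal ENNReal

/-- The cone `ℝ₊ᵈ`. -/
abbrev Orthant (d : ℕ) : Type := Fin d → ℝ≥0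

/-- The inclusion of `ℝ₊ᵈ` into `ℝᵈ`. -/
def Orthant.toVec {d : ℕ} (x : Orthant d) : Fin d → ℝ := fun i => (x i : ℝ)

theorem Orthant.continuous_toVec {d : ℕ} : Continuous (Orthant.toVec (d := d)) := by
  unfold Orthant.toVec
  fun_prop

/-- A `P`-module for `P = ℝ₊ᵈ`: a nonempty closed subset `A` of `ℝᵈ` with `A + P ⊆ A`. -/
structure PModule (d : ℕ) where
  carrier : Set (Fin d → ℝ)
  isClosed : IsClosed carrier
  nonempty : carrier.Nonempty
  add_mem : ∀ y ∈ carrier, ∀ x : Orthant d, y + x.toVec ∈ carrier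

variable {d : ℕ} {k : Type u} [NormedAddCommGroup k] [InnerProductSpace ℂ k]

theorem PModule.measurableSet (A : PModule d) : MeasurableSet A.carrier := A.isClosed.measurableSet

variable (k) in
/-- The Hilbert space `L²(A, k)`. -/
abbrev PModule.L2 (A : PModule d) : Type u := Lp k 2 (volume.restrict A.carrier)

/-- The shifted function `y ↦ f (y - x)` if `y - x ∈ A`, and `0` otherwise. -/
def shiftFun (A : Set (Fin d → ℝ)) (x : Fin d → ℝ) (f : (Fin d → ℝ) → k) : (Fin d → ℝ) → k :=
  {y | y - x ∈ A}.indicator fun y => f (y - x)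

theorem shiftFun_eq (A : Set (Fin d → ℝ)) (x : Fin d → ℝ) (f : (Fin d → ℝ) → k) :
    shiftFun A x f = fun y => A.indicator f (y - x) := rfl

theorem measurePreserving_sub_vec (x : Fin d → ℝ) :
    MeasurePreserving (fun y : Fin d → ℝ => y - x) volume volume :=
  measurePreserving_sub_right volume x

theorem shiftFun_congr {A : Set (Fin d → ℝ)} (hA : MeasurableSet A) (x : Fin d → ℝ)
    {f g : (Fin d → ℝ) → k} (h : f =ᵐ[volume.restrict A] g) :
    shiftFun A x f =ᵐ[volume] shiftFun A x g := by
  have h1 : A.indicator f =ᵐ[volume] A.indicator g := (ae_eq_restrict_iff_indicator_ae_eq hA).1 h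
  exact (measurePreserving_sub_vec x).quasiMeasurePreserving.ae_eq_comp h1

theorem eLpNorm_shiftFun (A : PModule d) (x : Orthant d) {f : (Fin d → ℝ) → k}
    (hf : AEStronglyMeasurable f (volume.restrict A.carrier)) :
    eLpNorm (shiftFun A.carrier x.toVec f) 2 (volume.restrict A.carrier) =
      eLpNorm f 2 (volume.restrict A.carrier) := by
  have h1 : A.carrier.indicator (shiftFun A.carrier x.toVec f) =
      shiftFun A.carrier x.toVec f := by
    rw [Set.indicator_eq_self]
    intro y hy
    have h2 : y - x.toVec ∈ A.carrier := by
      by_contra h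
      exact hy (Set.indicator_of_notMem (s := {y | y - x.toVec ∈ A.carrier}) h _)
    simpa using A.add_mem _ h2 x
  rw [← eLpNorm_indicator_eq_eLpNorm_restrict A.measurableSet, h1,
    ← eLpNorm_indicator_eq_eLpNorm_restrict A.measurableSet, shiftFun_eq]
  exact eLpNorm_comp_measurePreserving (g := A.carrier.indicator f)
    ((aestronglyMeasurable_indicator_iff A.measurableSet).2 hf) (measurePreserving_sub_vec x.toVec)

theorem memLp_shiftFun (A : PModule d) (x : Orthant d) {f : (Fin d → ℝ) → k}
    (hf : MemLp f 2 (volume.restrict A.carrier)) :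
    MemLp (shiftFun A.carrier x.toVec f) 2 (volume.restrict A.carrier) := by
  refine ⟨?_, by rw [eLpNorm_shiftFun A x hf.1]; exact hf.2⟩
  have h1 := (aestronglyMeasurable_indicator_iff A.measurableSet).2 hf.1
  exact (h1.comp_measurePreserving (measurePreserving_sub_vec x.toVec)).restrict

/-- The shift operator `S^A_x` on `L²(A, k)`: `(S^A_x f)(y) = f (y - x)` if `y - x ∈ A`, and
`0` otherwise. -/
def shift (A : PModule d) (x : Orthant d) : A.L2 k →ₗᵢ[ℂ] A.L2 k where
  toFun f := (memLp_shiftFun A x (Lp.memLp f)).toLp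
  map_add' f g := by
    rw [← MemLp.toLp_add, MemLp.toLp_eq_toLp_iff]
    refine ae_restrict_of_ae ?_
    refine (shiftFun_congr A.measurableSet _ (Lp.coeFn_add f g)).trans (ae_of_all _ fun y => ?_)
    simp only [shiftFun_eq, Set.indicator_add', Pi.add_apply]
  map_smul' c f := by
    rw [RingHom.id_apply, ← MemLp.toLp_const_smul, MemLp.toLp_eq_toLp_iff]
    refine ae_restrict_of_ae ?_
    refine (shiftFun_congr A.measurableSet _ (Lp.coeFn_smul c f)).trans (ae_of_all _ fun y => ?_)
    simp only [shiftFun_eq, Pi.smul_apply]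
    exact congrFun (Set.indicator_const_smul A.carrier c f) _
  norm_map' f := by
    change ‖(memLp_shiftFun A x (Lp.memLp f)).toLp‖ = _
    rw [Lp.norm_toLp, eLpNorm_shiftFun A x (Lp.memLp f).1, Lp.norm_def]

theorem coeFn_shift (A : PModule d) (x : Orthant d) (f : A.L2 k) :
    shift A x f =ᵐ[volume.restrict A.carrier] shiftFun A.carrier x.toVec f :=
  MemLp.coeFn_toLp (memLp_shiftFun A x (Lp.memLp f))

theorem shift_add (A : PModule d) (x y : Orthant d) (f : A.L2 k) :
    shift A (x + y) f = shift A x (shift A y f) := by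
  apply Lp.ext
  refine (coeFn_shift A _ f).trans (EventuallyEq.trans ?_ (coeFn_shift A x _).symm)
  have h1 : shiftFun A.carrier x.toVec (shift A y f) =ᵐ[volume.restrict A.carrier]
      shiftFun A.carrier x.toVec (shiftFun A.carrier y.toVec f) :=
    ae_restrict_of_ae (shiftFun_congr A.measurableSet x.toVec (coeFn_shift A y f))
  refine EventuallyEq.trans (ae_of_all _ fun z => ?_) h1.symm
  have hxy : z - (x + y).toVec = z - x.toVec - y.toVec := by
    rw [sub_sub]; rfl
  simp only [shiftFun_eq]
  by_cases h : z - x.toVec - y.toVec ∈ A.carrier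
  · have h' : z - x.toVec ∈ A.carrier := by simpa using A.add_mem _ h y
    rw [hxy, Set.indicator_of_mem h', Set.indicator_of_mem h]
  · rw [hxy, Set.indicator_of_notMem h]
    by_cases h' : z - x.toVec ∈ A.carrier
    · rw [Set.indicator_of_mem h', Set.indicator_of_notMem h]
    · rw [Set.indicator_of_notMem h']

theorem memLp_indicator (A : PModule d) (f : A.L2 k) :
    MemLp (A.carrier.indicator (f : (Fin d → ℝ) → k)) 2 volume :=
  (memLp_indicator_iff_restrict A.measurableSet).2 (Lp.memLp f)

/-- Extension by zero, from `L²(A, k)` to `L²(ℝᵈ, k)`. -/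
def extendZero (A : PModule d) (f : A.L2 k) : Lp k 2 (volume : Measure (Fin d → ℝ)) :=
  (memLp_indicator A f).toLp

theorem coeFn_extendZero (A : PModule d) (f : A.L2 k) :
    extendZero A f =ᵐ[volume] A.carrier.indicator (f : (Fin d → ℝ) → k) :=
  MemLp.coeFn_toLp (memLp_indicator A f)

/-- Translation on `L²(ℝᵈ, k)`. -/
def translate (x : Fin d → ℝ) (f : Lp k 2 (volume : Measure (Fin d → ℝ))) :
    Lp k 2 (volume : Measure (Fin d → ℝ)) :=
  Lp.compMeasurePreserving (fun y => y - x) (measurePreserving_sub_vec x) f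

theorem continuous_translate (f : Lp k 2 (volume : Measure (Fin d → ℝ))) :
    Continuous fun x => translate x f := by
  let g : C(Fin d → ℝ, C(Fin d → ℝ, Fin d → ℝ)) :=
    ContinuousMap.curry ⟨fun p => p.2 - p.1, by fun_prop⟩
  exact Continuous.compMeasurePreservingLp (f := fun _ => f) (g := g) continuous_const
    g.continuous (fun x => measurePreserving_sub_vec x) (by simp)

theorem inner_translate (x : Fin d → ℝ) (f g : Lp k 2 (volume : Measure (Fin d → ℝ))) :
    ⟪translate x f, g⟫_ℂ = ⟪f, translate (-x) g⟫_ℂ := by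
  have h1 : translate x (translate (-x) g) = g := by
    apply Lp.ext
    refine (Lp.coeFn_compMeasurePreserving _ (measurePreserving_sub_vec x)).trans ?_
    refine ((measurePreserving_sub_vec x).quasiMeasurePreserving.ae_eq_comp
      (Lp.coeFn_compMeasurePreserving g (measurePreserving_sub_vec (-x)))).trans ?_
    refine ae_of_all _ fun y => ?_
    simp
  conv_lhs => rw [← h1]
  exact (Lp.compMeasurePreservingₗᵢ ℂ _ (measurePreserving_sub_vec x)).inner_map_map f _

/-- Restriction, from `L²(ℝᵈ, k)` to `L²(A, k)`. -/
def restrictL2 (A : PModule d) (f : Lp k 2 (volume : Measure (Fin d → ℝ))) : A.L2 k :=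
  ((Lp.memLp f).restrict A.carrier).toLp

theorem coeFn_restrictL2 (A : PModule d) (f : Lp k 2 (volume : Measure (Fin d → ℝ))) :
    restrictL2 A f =ᵐ[volume.restrict A.carrier] f :=
  MemLp.coeFn_toLp ((Lp.memLp f).restrict A.carrier)

theorem continuous_restrictL2 (A : PModule d) :
    Continuous (restrictL2 A : Lp k 2 (volume : Measure (Fin d → ℝ)) → A.L2 k) :=
  (LpToLpRestrictCLM (Fin d → ℝ) k ℂ volume 2 A.carrier).continuous

theorem inner_restrict (A : PModule d) (f : Lp k 2 (volume : Measure (Fin d → ℝ)))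
    (g : A.L2 k) :
    ⟪restrictL2 A f, g⟫_ℂ = ⟪f, extendZero A g⟫_ℂ := by
  rw [L2.inner_def, L2.inner_def]
  have h1 : (fun y => ⟪f y, extendZero A g y⟫_ℂ) =ᵐ[volume]
      A.carrier.indicator (fun y => ⟪f y, g y⟫_ℂ) := by
    filter_upwards [coeFn_extendZero A g] with y hy
    rw [hy]
    by_cases h : y ∈ A.carrier
    · rw [Set.indicator_of_mem h, Set.indicator_of_mem h]
    · rw [Set.indicator_of_notMem h, Set.indicator_of_notMem h, inner_zero_right]
  rw [integral_congr_ae h1, integral_indicator A.measurableSet]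
  refine integral_congr_ae ?_
  filter_upwards [coeFn_restrictL2 A f] with y hy
  rw [hy]

theorem shift_eq (A : PModule d) (x : Orthant d) (f : A.L2 k) :
    shift A x f = restrictL2 A
      (translate x.toVec (extendZero A f)) := by
  apply Lp.ext
  refine (coeFn_shift A x f).trans (EventuallyEq.trans ?_ (coeFn_restrictL2 A _).symm)
  refine ae_restrict_of_ae ?_
  refine EventuallyEq.trans ?_
    (Lp.coeFn_compMeasurePreserving _ (measurePreserving_sub_vec x.toVec)).symm
  exact ((measurePreserving_sub_vec x.toVec).quasiMeasurePreserving.ae_eq_comp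
    (coeFn_extendZero A f)).symm

theorem adjoint_shift [CompleteSpace k] (A : PModule d) (x : Orthant d) (f : A.L2 k) :
    ContinuousLinearMap.adjoint (shift A x).toContinuousLinearMap f =
      restrictL2 A
        (translate (-x.toVec) (extendZero A f)) := by
  refine ext_inner_left ℂ fun g => ?_
  rw [ContinuousLinearMap.adjoint_inner_right]
  change ⟪shift A x g, f⟫_ℂ = _
  rw [shift_eq, inner_restrict, inner_translate, ← inner_conj_symm, ← inner_restrict,
    inner_conj_symm]

variable (k) in
/-- The isometric representation `S^A` of `ℝ₊ᵈ` on `L²(A, k)` by shifts. -/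
def shiftRep [CompleteSpace k] (A : PModule d) : IsometricRep (Orthant d) (A.L2 k) where
  toFun x := shift A x
  map_add := shift_add A
  continuous f := by
    simp only [shift_eq]
    exact (continuous_restrictL2 A).comp
      ((continuous_translate _).comp Orthant.continuous_toVec)
  continuous_adjoint f := by
    simp only [adjoint_shift]
    exact (continuous_restrictL2 A).comp
      ((continuous_translate _).comp Orthant.continuous_toVec.neg)

/-- The module `×ᵢ R i`, where each factor `R i` is `ℝ` or `ℝ₊`. -/
def prodModule (R : Fin d → Set ℝ) (hR : ∀ i, R i = Set.univ ∨ R i = Set.Ici 0) : PModule d where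
  carrier := Set.univ.pi R
  isClosed := isClosed_set_pi fun i _ => by
    rcases hR i with h | h <;> rw [h]
    · exact isClosed_univ
    · exact isClosed_Ici
  nonempty := ⟨0, fun i _ => by
    rcases hR i with h | h <;> rw [h]
    · exact Set.mem_univ _
    · exact le_refl (0 : ℝ)⟩
  add_mem := by
    intro y hy x i hi
    have h0 := hy i hi
    rcases hR i with h | h <;> rw [h] at h0 ⊢
    · exact Set.mem_univ _
    · exact add_nonneg h0 (x i).2

/-- The module `A_T^{(a,b)} = [a, ∞) × [b, ∞) ∪ [0, ∞) × [0, b)` in `ℝ²`, for `a < 0 < b`. -/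
def tModule (a b : ℝ) (ha : a < 0) (hb : 0 < b) : PModule 2 where
  carrier := {y | y 0 ∈ Set.Ici a ∧ y 1 ∈ Set.Ici b} ∪ {y | y 0 ∈ Set.Ici 0 ∧ y 1 ∈ Set.Ico 0 b}
  isClosed := by
    have h : ({y | y 0 ∈ Set.Ici a ∧ y 1 ∈ Set.Ici b} ∪
        {y | y 0 ∈ Set.Ici 0 ∧ y 1 ∈ Set.Ico 0 b} : Set (Fin 2 → ℝ)) =
        {y | a ≤ y 0 ∧ b ≤ y 1} ∪ {y | 0 ≤ y 0 ∧ 0 ≤ y 1} := by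
      ext y
      simp only [Set.mem_union, Set.mem_ofPred_eq, Set.mem_Ici, Set.mem_Ico]
      constructor
      · rintro (h | h)
        · exact Or.inl h
        · exact Or.inr ⟨h.1, h.2.1⟩
      · rintro (h | h)
        · exact Or.inl h
        · rcases lt_or_ge (y 1) b with h' | h'
          · exact Or.inr ⟨h.1, h.2, h'⟩
          · exact Or.inl ⟨ha.le.trans h.1, h'⟩
    rw [h]
    exact ((isClosed_le continuous_const (continuous_apply 0)).inter
      (isClosed_le continuous_const (continuous_apply 1))).union
      ((isClosed_le continuous_const (continuous_apply 0)).inter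
      (isClosed_le continuous_const (continuous_apply 1)))
  nonempty := ⟨0, Or.inr ⟨le_refl (0 : ℝ), le_refl (0 : ℝ), hb⟩⟩
  add_mem := by
    intro y hy x
    have h0 : (0 : ℝ) ≤ x.toVec 0 := (x 0).2
    have h1 : (0 : ℝ) ≤ x.toVec 1 := (x 1).2
    simp only [Set.mem_union, Set.mem_ofPred_eq, Set.mem_Ici, Set.mem_Ico, Pi.add_apply] at hy ⊢
    rcases hy with h | h
    · left; constructor <;> linarith
    · rcases lt_or_ge (y 1 + x.toVec 1) b with h' | h'
      · right; refine ⟨?_, ?_, h'⟩ <;> linarith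
      · left; constructor <;> linarith

end Shift

end CCR

end

/-
For a Fock cocycle `ζ` of an isometric representation `V` put `F_x(v) = ⟪e(v), ζ_x⟫`. Commutativity
of `P` gives `F_x(v) F_y(V_x^* v) = F_y(v) F_x(V_y^* v)`, and `F_y(V_y v) = 1`. If
`V_y^* V_{z_n} v = 0` for all `n` and `V_{z_n} v → 0` weakly, then
`F_y(v) = F_y(V_{z_n} v) → F_y(0) = 1`.
For the shifts on `A`, let `v` have bounded support, let `y` be a large translation along a
coordinate which is bounded below on `A`, and let `z_n` go to infinity along another coordinate.
Both `v` and `V_x^* v` then satisfy the hypothesis above, and `V_y^* v = 0`, so the commutation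
relation reduces to `F_x(v) = 1`. By density `ζ_x` is the vacuum `Ω = e(0)`.

An additive cocycle `h` gives the Fock cocycle `e(h_x)`, so `h = 0`. For a unit `u`, testing the
intertwining relation on rank-one operators shows that `c(x) = ⟪Ω, u_x Ω⟫` is a continuous
character and that `c(x)⁻¹ u_x Ω` is a Fock cocycle, whence `u_x = c(x) Γ(V_x)`; and continuous
characters of `ℝ₊ᵈ` are exponentials.
-/

noncomputable section

namespace CCR

universe u

open MeasureTheory ContinuousLinearMap Filter Topology
open scoped NNReal ENNReal

section Fock

variable {K : Type u} [NormedAddCommGroup K] [InnerProductSpace ℂ K]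

theorem norm_expVec_sq (v : K) : ‖expVec v‖ ^ 2 = Real.exp (‖v‖ ^ 2) := by
  have h := inner_expVec v v
  rw [inner_self_eq_norm_sq_to_K, inner_self_eq_norm_sq_to_K] at h
  rw [← Complex.ofReal_inj]
  push_cast
  exact h

theorem norm_expVec (v : K) : ‖expVec v‖ = √(Real.exp (‖v‖ ^ 2)) := by
  rw [← norm_expVec_sq, Real.sqrt_sq (norm_nonneg _)]

theorem expVec_eq_expVec_zero_iff {v : K} : expVec v = expVec 0 ↔ v = 0 := by
  refine ⟨fun h => ?_, fun h => h ▸ rfl⟩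
  have hexp : Real.exp (‖v‖ ^ 2) = Real.exp (‖(0 : K)‖ ^ 2) := by
    rw [← norm_expVec_sq, h, norm_expVec_sq]
  simpa using hexp

theorem tendsto_inner_expVec {X : Type*} {l : Filter X} {f : X → K} {f₀ : K} {C : ℝ}
    (hf : ∀ᶠ x in l, ‖f x‖ ≤ C) (h : ∀ w, Tendsto (fun x => ⟪f x, w⟫_ℂ) l (𝓝 ⟪f₀, w⟫_ℂ))
    (ζ : Fock K) : Tendsto (fun x => ⟪expVec (f x), ζ⟫_ℂ) l (𝓝 ⟪expVec f₀, ζ⟫_ℂ) := by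
  refine isTotal_expVec.tendsto_right (C := √(Real.exp (C ^ 2))) ?_ (fun w => ?_) ζ
  · filter_upwards [hf] with x hx
    rw [norm_expVec]
    gcongr
  · simp only [inner_expVec]
    exact (Complex.continuous_exp.tendsto _).comp (h w)

theorem eq_expVec_zero_of_dense {ζ : Fock K} {D : Set K} (hD : Dense D)
    (h : ∀ v ∈ D, ⟪expVec v, ζ⟫_ℂ = 1) : ζ = expVec 0 := by
  have hcont : Continuous fun v : K => ⟪expVec v, ζ⟫_ℂ := continuous_expVec.inner continuous_const
  refine isTotal_expVec.ext_vec fun v => ?_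
  rw [congrFun (hcont.ext_on hD continuous_const h) v, inner_expVec, inner_zero_right,
    Complex.exp_zero]

theorem IsTotal.continuous_linearIsometry_apply {X ι H H' : Type*} [TopologicalSpace X]
    [NormedAddCommGroup H] [InnerProductSpace ℂ H] [NormedAddCommGroup H'] [NormedSpace ℂ H']
    {a : ι → H} (ha : IsTotal a) {S : X → H →ₗᵢ[ℂ] H'} (hS : ∀ i, Continuous fun x => S x (a i))
    (η : H) : Continuous fun x => S x η := by
  have hequi : Equicontinuous fun x => (S x : H → H') :=
    (LipschitzWith.uniformEquicontinuous _ 1 fun x => (S x).lipschitz).equicontinuous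
  have hclosed : IsClosed {η | Continuous fun x => S x η} := by
    simp only [continuous_iff_continuousAt, ContinuousAt, Set.ofPred_forall]
    exact isClosed_iInter fun x => hequi.isClosed_setOfPred_tendsto (S x).continuous
  refine hclosed.closure_subset_iff.2 (fun ξ hξ => ?_) (ha η)
  simp only [SetLike.mem_coe, Set.mem_ofPred_eq] at hξ ⊢
  induction hξ using Submodule.span_induction with
  | mem _ h =>
    obtain ⟨i, rfl⟩ := h
    exact hS i
  | zero => simpa only [map_zero] using continuous_const
  | add b c _ _ hb hc => simp only [map_add]; exact hb.add hc
  | smul t b _ hb => simp only [map_smul]; exact hb.const_smul t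

theorem htmul_smul {E F : Type*} [NormedAddCommGroup E] [InnerProductSpace ℂ E]
    [NormedAddCommGroup F] [InnerProductSpace ℂ F] (c : ℂ) (x : E) (y : F) :
    htmul x (c • y) = c • htmul x y := by
  rw [htmul, TensorProduct.tmul_smul, UniformSpace.Completion.coe_smul, ← htmul]

end Fock

section Cocycle

variable {P : Type*} [AddCommMonoid P] [TopologicalSpace P]
  {K : Type u} [NormedAddCommGroup K] [InnerProductSpace ℂ K] [CompleteSpace K]

/-- The adjoint of the isometry `V_x`. -/
def IsometricRep.adj (V : IsometricRep P K) (x : P) : K →L[ℂ] K :=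
  adjoint (V.toFun x).toContinuousLinearMap

theorem IsometricRep.inner_adj_left (V : IsometricRep P K) (x : P) (v w : K) :
    ⟪V.adj x v, w⟫_ℂ = ⟪v, V.toFun x w⟫_ℂ :=
  adjoint_inner_left _ _ _

theorem IsometricRep.inner_adj_right (V : IsometricRep P K) (x : P) (v w : K) :
    ⟪v, V.adj x w⟫_ℂ = ⟪V.toFun x v, w⟫_ℂ :=
  adjoint_inner_right _ _ _

theorem IsometricRep.norm_adj_le (V : IsometricRep P K) (x : P) : ‖V.adj x‖ ≤ 1 :=
  (adjoint.norm_map _).trans_le (V.toFun x).norm_toContinuousLinearMap_le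

theorem IsometricRep.adj_apply_self (V : IsometricRep P K) (x : P) (v : K) :
    V.adj x (V.toFun x v) = v :=
  adjoint_apply_self _ _

theorem IsometricRep.adj_zero (V : IsometricRep P K) (v : K) : V.adj 0 v = v := by
  simpa only [V.map_zero] using V.adj_apply_self 0 v

theorem IsometricRep.adj_add (V : IsometricRep P K) (x y : P) (v : K) :
    V.adj (x + y) v = V.adj y (V.adj x v) :=
  ext_inner_right ℂ fun w => by simp only [V.inner_adj_left, V.map_add]

theorem IsometricRep.adj_comm (V : IsometricRep P K) (x y : P) (v : K) :
    V.adj x (V.adj y v) = V.adj y (V.adj x v) := by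
  rw [← V.adj_add, ← V.adj_add, add_comm]

/-- Normalised multiplicative cocycles `ζ_{x+y} = ζ_x ⊗ Γ(V_x) ζ_y` of `V` in the Fock space. The
cocycle identity is tested against exponential vectors, and of the condition that `ζ_x` lies in
`Γ(ker V_x^*) ⊗ Ω` only its consequence for the vectors `e(V_x v)` is recorded. -/
structure IsFockCocycle (V : IsometricRep P K) (ζ : P → Fock K) : Prop where
  inner_add : ∀ x y v,
    ⟪expVec v, ζ (x + y)⟫_ℂ = ⟪expVec v, ζ x⟫_ℂ * ⟪expVec (V.adj x v), ζ y⟫_ℂ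
  inner_range : ∀ x v, ⟪expVec (V.toFun x v), ζ x⟫_ℂ = 1

/-- The vacuum is the only Fock cocycle of `V`. This condition forces the additive cocycles of `V`
to vanish and determines the units of its CCR flow. -/
def HasTrivialFockCocycles (V : IsometricRep P K) : Prop :=
  ∀ ζ, IsFockCocycle V ζ → ∀ x, ζ x = expVec 0

section FockCocycle

variable {V : IsometricRep P K} {ζ : P → Fock K}

theorem IsFockCocycle.inner_zero (hζ : IsFockCocycle V ζ) (x : P) : ⟪expVec 0, ζ x⟫_ℂ = 1 := by
  simpa only [map_zero] using hζ.inner_range x 0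

theorem IsFockCocycle.inner_mul_comm (hζ : IsFockCocycle V ζ) (x y : P) (v : K) :
    ⟪expVec v, ζ x⟫_ℂ * ⟪expVec (V.adj x v), ζ y⟫_ℂ =
      ⟪expVec v, ζ y⟫_ℂ * ⟪expVec (V.adj y v), ζ x⟫_ℂ := by
  rw [← hζ.inner_add, ← hζ.inner_add, add_comm]

theorem IsFockCocycle.inner_shift_of_adj_shift_eq_zero (hζ : IsFockCocycle V ζ) {y z : P} {v : K}
    (h : V.adj y (V.toFun z v) = 0) :
    ⟪expVec (V.toFun z v), ζ y⟫_ℂ = ⟪expVec v, ζ y⟫_ℂ := by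
  simpa only [h, hζ.inner_zero, mul_one, hζ.inner_range, one_mul, V.adj_apply_self] using
    hζ.inner_mul_comm y z (V.toFun z v)

theorem IsFockCocycle.inner_eq_one_of_adj_shift_eq_zero (hζ : IsFockCocycle V ζ) {ι : Type*}
    {l : Filter ι} [l.NeBot] {z : ι → P} {v : K}
    (hz : ∀ w, Tendsto (fun n => ⟪V.toFun (z n) v, w⟫_ℂ) l (𝓝 0)) {y : P}
    (h : ∀ n, V.adj y (V.toFun (z n) v) = 0) : ⟪expVec v, ζ y⟫_ℂ = 1 := by
  have hlim : Tendsto (fun n => ⟪expVec (V.toFun (z n) v), ζ y⟫_ℂ) l (𝓝 ⟪expVec 0, ζ y⟫_ℂ) :=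
    tendsto_inner_expVec (.of_forall fun n => ((V.toFun (z n)).norm_map v).le)
      (by simpa only [inner_zero_left] using hz) _
  simp only [hζ.inner_shift_of_adj_shift_eq_zero (h _), hζ.inner_zero] at hlim
  exact tendsto_nhds_unique tendsto_const_nhds hlim

theorem hasTrivialFockCocycles_of_dense {ι : Type*} {l : Filter ι} [l.NeBot] {z : ι → P}
    (hz : ∀ v w, Tendsto (fun n => ⟪V.toFun (z n) v, w⟫_ℂ) l (𝓝 0))
    (hV : Dense {v | ∃ y, ∀ x n, V.adj y (V.toFun (z n) (V.adj x v)) = 0}) :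
    HasTrivialFockCocycles V := by
  refine fun ζ hζ x => eq_expVec_zero_of_dense hV ?_
  rintro v ⟨y, hy⟩
  have hy₀ : ∀ n, V.adj y (V.toFun (z n) v) = 0 := by simpa only [V.adj_zero] using hy 0
  have hker : V.adj y v = 0 := by
    obtain ⟨n⟩ := l.nonempty_of_neBot
    rw [← V.adj_apply_self (z n) v, V.adj_comm, hy₀, map_zero]
  have hone : ⟪expVec v, ζ y⟫_ℂ = 1 := hζ.inner_eq_one_of_adj_shift_eq_zero (hz v) hy₀
  have hone' : ⟪expVec (V.adj x v), ζ y⟫_ℂ = 1 :=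
    hζ.inner_eq_one_of_adj_shift_eq_zero (hz _) (hy x)
  simpa only [hone, hone', hker, hζ.inner_zero, mul_one] using hζ.inner_mul_comm x y v

end FockCocycle

section AdditiveCocycle

variable {V : IsometricRep P K}

theorem IsAdditiveCocycle.isFockCocycle {h : P → K} (hh : IsAdditiveCocycle V h) :
    IsFockCocycle V fun x => expVec (h x) where
  inner_add x y v := by
    simp only [inner_expVec, ← Complex.exp_add, hh.map_add, inner_add_right, V.inner_adj_left]
  inner_range x v := by
    have hker : V.adj x (h x) = 0 := hh.mem_ker x
    rw [inner_expVec, ← V.inner_adj_right, hker, inner_zero_right, Complex.exp_zero]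

theorem isAdditiveCocycle_zero (V : IsometricRep P K) : IsAdditiveCocycle V 0 where
  continuous := continuous_zero
  mem_ker _ := map_zero _
  map_add x y := by simp

theorem HasTrivialFockCocycles.setOf_isAdditiveCocycle_eq (hV : HasTrivialFockCocycles V) :
    {h | IsAdditiveCocycle V h} = {0} := by
  refine Set.eq_singleton_iff_unique_mem.2 ⟨isAdditiveCocycle_zero V, fun h hh => ?_⟩
  funext x
  exact expVec_eq_expVec_zero_iff.1 (hV _ hh.isFockCocycle x)

end AdditiveCocycle

section Units

variable {V : IsometricRep P K} {u : P → Fock K →L[ℂ] Fock K}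

theorem ccrEndo_rankOne_apply (W : K →ₗᵢ[ℂ] K) (η : Fock K) (v : K) :
    ccrEndo W (InnerProductSpace.rankOne ℂ (expVec 0) η) (expVec v) =
      ⟪η, expVec (adjoint W.toContinuousLinearMap v)⟫_ℂ •
        expVec (v - W (adjoint W.toContinuousLinearMap v)) := by
  obtain ⟨w, hw⟩ := exists_ker_add W v
  have hsplit := fockSplit_htmul W w (adjoint W.toContinuousLinearMap v)
  have hsplit₀ := fockSplit_htmul W w 0
  rw [hw] at hsplit
  rw [map_zero, add_zero] at hsplit₀
  rw [← hsplit, ccrEndo_apply_fockSplit, idTensor_htmul, InnerProductSpace.rankOne_apply,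
    htmul_smul, (fockSplit W).map_smul, hsplit₀, eq_sub_of_add_eq hw]

theorem IsUnitOf.apply_eq_ccrEndo_rankOne (hu : IsUnitOf (ccrFlow V) u) (x : P) (η : Fock K) :
    u x η = ccrEndo (V.toFun x) (InnerProductSpace.rankOne ℂ η (expVec 0)) (u x (expVec 0)) := by
  have h := congrArg (fun A : Fock K →L[ℂ] Fock K => A (expVec 0))
    (hu.intertwine x (InnerProductSpace.rankOne ℂ η (expVec 0)))
  simp only [comp_apply, InnerProductSpace.rankOne_apply, inner_expVec, inner_zero_left,
    Complex.exp_zero, one_smul] at h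
  exact h.symm

theorem IsUnitOf.inner_apply_eq_mul_inner_sub (hu : IsUnitOf (ccrFlow V) u) (x : P) (v : K)
    (η : Fock K) :
    ⟪expVec v, u x η⟫_ℂ = ⟪expVec (V.adj x v), η⟫_ℂ *
      ⟪expVec (v - V.toFun x (V.adj x v)), u x (expVec 0)⟫_ℂ := by
  rw [hu.apply_eq_ccrEndo_rankOne, ← adjoint_inner_left, ← star_eq_adjoint, ← map_star,
    star_eq_adjoint, InnerProductSpace.adjoint_rankOne, ccrEndo_rankOne_apply, inner_smul_left,
    inner_conj_symm]
  rfl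

theorem IsUnitOf.inner_apply (hu : IsUnitOf (ccrFlow V) u) (x : P) (v : K) (η : Fock K) :
    ⟪expVec v, u x η⟫_ℂ = ⟪expVec (V.adj x v), η⟫_ℂ * ⟪expVec v, u x (expVec 0)⟫_ℂ := by
  rw [hu.inner_apply_eq_mul_inner_sub x v η, hu.inner_apply_eq_mul_inner_sub x v (expVec 0)]
  simp only [inner_expVec, inner_zero_right, Complex.exp_zero, one_mul]

/-- The vacuum expectation of a family of operators on the Fock space. -/
def vacuumExp (u : P → Fock K →L[ℂ] Fock K) (x : P) : ℂ := ⟪expVec 0, u x (expVec 0)⟫_ℂ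

theorem IsUnitOf.inner_range (hu : IsUnitOf (ccrFlow V) u) (x : P) (v : K) :
    ⟪expVec (V.toFun x v), u x (expVec 0)⟫_ℂ = vacuumExp u x := by
  rw [hu.inner_apply_eq_mul_inner_sub, V.adj_apply_self, sub_self, inner_expVec, inner_zero_right,
    Complex.exp_zero, one_mul, vacuumExp]

theorem IsUnitOf.vacuumExp_add (hu : IsUnitOf (ccrFlow V) u) (x y : P) :
    vacuumExp u (x + y) = vacuumExp u x * vacuumExp u y := by
  rw [vacuumExp, hu.map_add, comp_apply, hu.inner_apply, map_zero, mul_comm, vacuumExp, vacuumExp]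

theorem IsUnitOf.continuous_vacuumExp (hu : IsUnitOf (ccrFlow V) u) : Continuous (vacuumExp u) :=
  continuous_const.inner (hu.continuous _)

theorem IsUnitOf.apply_zero (hu : IsUnitOf (ccrFlow V) u) : u 0 = vacuumExp u 0 • 1 := by
  refine isTotal_expVec.ext fun w => isTotal_expVec.ext_vec fun v => ?_
  have hv := hu.inner_range 0 v
  rw [V.map_zero] at hv
  rw [hu.inner_apply, hv, V.adj_zero, smul_apply, one_apply_eq_self, inner_smul_right, mul_comm]

theorem IsUnitOf.vacuumExp_zero (hu : IsUnitOf (ccrFlow V) u) : vacuumExp u 0 = 1 := by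
  obtain ⟨x, hx⟩ := hu.exists_ne_zero
  refine smul_left_injective ℂ hx ?_
  change vacuumExp u 0 • u x = (1 : ℂ) • u x
  conv_rhs => rw [one_smul, ← add_zero x, hu.map_add, hu.apply_zero]
  ext η : 1
  simp

theorem IsUnitOf.isFockCocycle (hu : IsUnitOf (ccrFlow V) u) (h0 : ∀ x, vacuumExp u x ≠ 0) :
    IsFockCocycle V fun x => (vacuumExp u x)⁻¹ • u x (expVec 0) where
  inner_add x y v := by
    simp only [inner_smul_right]
    rw [hu.map_add, comp_apply, hu.inner_apply, hu.vacuumExp_add, mul_inv]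
    ring
  inner_range x v := by rw [inner_smul_right, hu.inner_range, inv_mul_cancel₀ (h0 x)]

theorem inner_expVec_secondQuant (V : IsometricRep P K) (x : P) (v : K) (η : Fock K) :
    ⟪expVec v, secondQuant (V.toFun x) η⟫_ℂ = ⟪expVec (V.adj x v), η⟫_ℂ := by
  rw [← LinearIsometry.coe_toContinuousLinearMap, ← adjoint_inner_left]
  congr 1
  refine isTotal_expVec.ext_vec fun w => ?_
  rw [adjoint_inner_right, LinearIsometry.coe_toContinuousLinearMap, secondQuant_expVec,
    inner_expVec, inner_expVec, V.inner_adj_right]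

theorem IsUnitOf.eq_smul_secondQuant (hu : IsUnitOf (ccrFlow V) u) (h0 : ∀ x, vacuumExp u x ≠ 0)
    (hV : HasTrivialFockCocycles V) (x : P) :
    u x = vacuumExp u x • (secondQuant (V.toFun x)).toContinuousLinearMap := by
  have hvac : u x (expVec 0) = vacuumExp u x • expVec 0 :=
    (inv_smul_eq_iff₀ (h0 x)).1 (hV _ (hu.isFockCocycle h0) x)
  refine isTotal_expVec.ext fun w => isTotal_expVec.ext_vec fun v => ?_
  rw [hu.inner_apply, hvac, smul_apply, LinearIsometry.coe_toContinuousLinearMap, inner_smul_right,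
    inner_smul_right, inner_expVec_secondQuant, inner_expVec v 0, inner_zero_right,
    Complex.exp_zero, mul_one, mul_comm]

theorem continuous_secondQuant (V : IsometricRep P K) (η : Fock K) :
    Continuous fun x => secondQuant (V.toFun x) η :=
  isTotal_expVec.continuous_linearIsometry_apply (fun v => by
    simp only [secondQuant_expVec]; exact continuous_expVec.comp (V.continuous v)) η

theorem ccrEndo_secondQuant (V : IsometricRep P K) (x : P) (T : Fock K →L[ℂ] Fock K)
    (η : Fock K) :
    ccrEndo (V.toFun x) T (secondQuant (V.toFun x) η) = secondQuant (V.toFun x) (T η) := by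
  suffices h : ccrEndo (V.toFun x) T ∘L (secondQuant (V.toFun x)).toContinuousLinearMap =
      (secondQuant (V.toFun x)).toContinuousLinearMap ∘L T from congrArg (· η) h
  refine isTotal_expVec.ext fun w => isTotal_expVec.ext_vec fun v => ?_
  simp only [comp_apply, LinearIsometry.coe_toContinuousLinearMap, inner_expVec_secondQuant,
    secondQuant_expVec, inner_ccrEndo, adjoint_apply_self]
  change Complex.exp (⟪v, V.toFun x w⟫_ℂ - ⟪V.adj x v, w⟫_ℂ) * _ = _
  rw [V.inner_adj_left, sub_self, Complex.exp_zero, one_mul]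
  rfl

theorem isUnitOf_smul_secondQuant (V : IsometricRep P K) {c : P → ℂ} (hc : Continuous c)
    (h0 : c 0 ≠ 0) (hadd : ∀ x y, c (x + y) = c x * c y) :
    IsUnitOf (ccrFlow V) fun x => c x • (secondQuant (V.toFun x)).toContinuousLinearMap where
  continuous η := hc.smul (continuous_secondQuant V η)
  intertwine x T := by
    ext η : 1
    simp only [comp_apply, smul_apply, map_smul, LinearIsometry.coe_toContinuousLinearMap]
    exact congrArg _ (ccrEndo_secondQuant V x T η)
  map_add x y := by
    refine isTotal_expVec.ext fun v => ?_
    simp only [comp_apply, smul_apply, map_smul, LinearIsometry.coe_toContinuousLinearMap,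
      secondQuant_expVec, V.map_add, smul_smul, hadd, mul_comm (c y)]
  exists_ne_zero := by
    refine ⟨0, fun h => h0 ?_⟩
    have hvac := congrArg (fun A : Fock K →L[ℂ] Fock K => ⟪expVec 0, A (expVec 0)⟫_ℂ) h
    simpa only [smul_apply, LinearIsometry.coe_toContinuousLinearMap, secondQuant_expVec,
      map_zero, inner_smul_right, inner_expVec, inner_zero_left, Complex.exp_zero, mul_one,
      zero_apply, inner_zero_right] using hvac

end Units

end Cocycle

section Character

theorem exists_pos_integral_ne_zero {E : Type*} [NormedAddCommGroup E] [NormedSpace ℝ E]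
    [CompleteSpace E] {g : ℝ → E} (hg : Continuous g) (h0 : g 0 ≠ 0) :
    ∃ δ : ℝ, 0 < δ ∧ ∫ s in (0 : ℝ)..δ, g s ≠ 0 := by
  have hderiv : HasDerivAt (fun t => ∫ s in (0 : ℝ)..t, g s) (g 0) 0 :=
    (hg.integral_hasStrictDerivAt 0 0).hasDerivAt
  have hne : ∀ᶠ t in 𝓝[>] (0 : ℝ), ∫ s in (0 : ℝ)..t, g s ≠ 0 :=
    (hderiv.eventually_ne h0).filter_mono (nhdsWithin_mono _ fun _ => ne_of_gt)
  exact (eventually_mem_nhdsWithin.and hne).exists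

theorem integral_add_right_eq_mul_of_map_add {g : ℝ → ℂ}
    (hadd : ∀ s t, 0 ≤ s → 0 ≤ t → g (s + t) = g s * g t) {t δ : ℝ} (ht : 0 ≤ t) (hδ : 0 ≤ δ) :
    ∫ s in t..t + δ, g s = g t * ∫ s in (0 : ℝ)..δ, g s := by
  have htrans := intervalIntegral.integral_comp_add_left (a := 0) (b := δ) g t
  rw [add_zero] at htrans
  rw [← htrans, ← intervalIntegral.integral_const_mul]
  refine intervalIntegral.integral_congr fun s hs => ?_
  rw [Set.uIcc_of_le hδ] at hs
  exact hadd t s ht hs.1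

/- Integrating `g (t + s) = g t * g s` over `s ∈ [0, δ]` expresses `g` as a difference of
antiderivatives of itself, whence it is differentiable. -/
theorem exists_hasDerivWithinAt_of_map_add {g : ℝ → ℂ} (hg : Continuous g) (h0 : g 0 = 1)
    (hadd : ∀ s t, 0 ≤ s → 0 ≤ t → g (s + t) = g s * g t) :
    ∃ μ : ℂ, ∀ t, 0 ≤ t → HasDerivWithinAt g (μ * g t) (Set.Ici t) t := by
  obtain ⟨δ, hδ, hI⟩ := exists_pos_integral_ne_zero hg (h0.trans_ne one_ne_zero)
  set J : ℝ → ℂ := fun t => ∫ s in (0 : ℝ)..t, g s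
  have hJ' : ∀ t, HasDerivAt J (g t) t := fun t => (hg.integral_hasStrictDerivAt 0 t).hasDerivAt
  have hgJ : ∀ t, 0 ≤ t → g t = (J (t + δ) - J t) / J δ := fun t ht => by
    rw [eq_div_iff hI, ← integral_add_right_eq_mul_of_map_add hadd ht hδ.le]
    exact (intervalIntegral.integral_interval_sub_left (hg.intervalIntegrable _ _)
      (hg.intervalIntegrable _ _)).symm
  refine ⟨(g δ - 1) / J δ, fun t ht => ?_⟩
  have hderiv : HasDerivAt (fun t => (J (t + δ) - J t) / J δ) ((g (t + δ) - g t) / J δ) t :=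
    (((hJ' (t + δ)).comp_add_const t δ).sub (hJ' t)).div_const _
  refine (hderiv.hasDerivWithinAt.congr (fun s hs => hgJ s (ht.trans hs)) (hgJ t ht)).congr_deriv ?_
  rw [hadd t δ ht hδ.le]
  ring

theorem eq_exp_mul_of_hasDerivWithinAt {g : ℝ → ℂ} {μ : ℂ} (hg : ContinuousOn g (Set.Ici 0))
    (hderiv : ∀ t, 0 ≤ t → HasDerivWithinAt g (μ * g t) (Set.Ici t) t) {t : ℝ} (ht : 0 ≤ t) :
    g t = Complex.exp (t * μ) * g 0 := by
  set q : ℝ → ℂ := fun t => g t * Complex.exp (-(t * μ)) with hq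
  have hexp : ∀ t : ℝ, HasDerivAt (fun t : ℝ => Complex.exp (-(t * μ)))
      (Complex.exp (-(t * μ)) * (-(1 * μ))) t := fun t =>
    (((Complex.ofRealCLM.hasDerivAt (x := t)).mul_const μ).neg).cexp
  have hq' : ∀ s ∈ Set.Ico 0 t, HasDerivWithinAt q 0 (Set.Ici s) s := fun s hs =>
    ((hderiv s hs.1).mul (hexp s).hasDerivWithinAt).congr_deriv (by ring)
  have hcont : ContinuousOn q (Set.Icc 0 t) :=
    (hg.mono Set.Icc_subset_Ici_self).mul fun s _ => (hexp s).continuousAt.continuousWithinAt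
  have hconst := constant_of_has_deriv_right_zero hcont hq' t ⟨ht, le_rfl⟩
  simp only [hq, Complex.ofReal_zero, zero_mul, neg_zero, Complex.exp_zero, mul_one] at hconst
  rw [← hconst, Complex.exp_neg, mul_comm (g t), mul_inv_cancel_left₀ (Complex.exp_ne_zero _)]

theorem exists_exp_of_continuous_of_map_add {f : ℝ≥0 → ℂ} (hf : Continuous f) (h0 : f 0 = 1)
    (hadd : ∀ s t, f (s + t) = f s * f t) : ∃ μ : ℂ, ∀ t : ℝ≥0, f t = Complex.exp (t * μ) := by
  have hcont : Continuous fun t : ℝ => f t.toNNReal := hf.comp continuous_real_toNNReal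
  obtain ⟨μ, hμ⟩ := exists_hasDerivWithinAt_of_map_add hcont (by simpa using h0)
    fun s t hs ht => by rw [Real.toNNReal_add hs ht, hadd]
  refine ⟨μ, fun t => ?_⟩
  simpa [h0] using eq_exp_mul_of_hasDerivWithinAt hcont.continuousOn hμ t.2

variable {d : ℕ}

theorem Orthant.exists_exp_of_continuous_of_map_add {c : Orthant d → ℂ} (hc : Continuous c)
    (h0 : c 0 = 1) (hadd : ∀ x y, c (x + y) = c x * c y) :
    ∃ μ : Fin d → ℂ, ∀ x, c x = Complex.exp (∑ i, (x i : ℂ) * μ i) := by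
  have hray : ∀ i, ∃ μ : ℂ, ∀ t : ℝ≥0, c (Pi.single i t) = Complex.exp (t * μ) := fun i =>
    CCR.exists_exp_of_continuous_of_map_add (f := fun t => c (Pi.single i t))
      (hc.comp (continuous_single (A := fun _ : Fin d => ℝ≥0) i)) (by simpa using h0)
      (fun s t => by rw [Pi.single_add, hadd])
  choose μ hμ using hray
  let χ : Multiplicative (Orthant d) →* ℂ :=
    { toFun := fun x => c x.toAdd, map_one' := h0, map_mul' := hadd }
  refine ⟨μ, fun x => ?_⟩
  calc c x = χ (.ofAdd (∑ i, Pi.single i (x i))) := by rw [Finset.univ_sum_single]; rfl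
    _ = ∏ i, c (Pi.single i (x i)) := by rw [ofAdd_sum, map_prod]; rfl
    _ = Complex.exp (∑ i, (x i : ℂ) * μ i) := by simp only [hμ, Complex.exp_sum]

theorem Orthant.continuous_exp (μ : Fin d → ℂ) :
    Continuous fun x : Orthant d => Complex.exp (∑ i, (x i : ℂ) * μ i) := by
  fun_prop

theorem Orthant.exp_add (μ : Fin d → ℂ) (x y : Orthant d) :
    Complex.exp (∑ i, ((x + y) i : ℂ) * μ i) =
      Complex.exp (∑ i, (x i : ℂ) * μ i) * Complex.exp (∑ i, (y i : ℂ) * μ i) := by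
  simp only [← Complex.exp_add, ← Finset.sum_add_distrib, ← add_mul, Pi.add_apply, NNReal.coe_add,
    Complex.ofReal_add]

end Character

section OrthantUnits

variable {d : ℕ} {K : Type u} [NormedAddCommGroup K] [InnerProductSpace ℂ K] [CompleteSpace K]
  {V : IsometricRep (Orthant d) K}

theorem isUnitOf_exp_smul_secondQuant (V : IsometricRep (Orthant d) K) (μ : Fin d → ℂ) :
    IsUnitOf (ccrFlow V) fun x => Complex.exp (∑ i, (x i : ℂ) * μ i) •
      (secondQuant (V.toFun x)).toContinuousLinearMap :=
  isUnitOf_smul_secondQuant V (Orthant.continuous_exp μ) (Complex.exp_ne_zero _)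
    (Orthant.exp_add μ)

theorem HasTrivialFockCocycles.unitSet_ccrFlow_eq (hV : HasTrivialFockCocycles V) :
    unitSet (ccrFlow V) = {u | ∃ μ : Fin d → ℂ, u = fun x => Complex.exp (∑ i, (x i : ℂ) * μ i) •
      (secondQuant (V.toFun x)).toContinuousLinearMap} := by
  refine Set.Subset.antisymm (fun u (hu : IsUnitOf _ u) => ?_) ?_
  · obtain ⟨μ, hμ⟩ := Orthant.exists_exp_of_continuous_of_map_add hu.continuous_vacuumExp
      hu.vacuumExp_zero hu.vacuumExp_add
    have h0 : ∀ x, vacuumExp u x ≠ 0 := fun x => hμ x ▸ Complex.exp_ne_zero _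
    exact ⟨μ, funext fun x => by rw [hu.eq_smul_secondQuant h0 hV, hμ]⟩
  · rintro _ ⟨μ, rfl⟩
    exact isUnitOf_exp_smul_secondQuant V μ

theorem HasTrivialFockCocycles.isTypeII0_ccrFlow (hV : HasTrivialFockCocycles V) :
    IsTypeII0 (ccrFlow V) := by
  refine ⟨_, isUnitOf_exp_smul_secondQuant V 0, fun v hv => ?_⟩
  rw [hV.unitSet_ccrFlow_eq] at hv
  obtain ⟨μ, rfl⟩ := hv
  exact ⟨fun x => Complex.exp (∑ i, (x i : ℂ) * μ i), fun x => by simp⟩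

end OrthantUnits

section Shift

variable {d : ℕ} {k : Type u} [NormedAddCommGroup k] {A : PModule d}
  {B C : Set (Fin d → ℝ)} {f g : A.L2 k}

/-- The function `f` on the `P`-module `A` vanishes almost everywhere outside `B`. -/
def SupportedIn (A : PModule d) (B : Set (Fin d → ℝ)) (f : A.L2 k) : Prop :=
  ∀ᵐ y ∂volume.restrict A.carrier, y ∉ B → f y = 0

theorem SupportedIn.eq_zero (hf : SupportedIn A B f) (h : Disjoint A.carrier B) : f = 0 := by
  rw [Lp.eq_zero_iff_ae_eq_zero]
  filter_upwards [hf, ae_restrict_mem A.measurableSet] with y hy hA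
  exact hy (h.notMem_of_mem_left hA)

theorem SupportedIn.mono (hf : SupportedIn A B f) (h : B ⊆ C) : SupportedIn A C f :=
  Eventually.mono hf fun _ hy hC => hy fun hB => hC (h hB)

theorem quasiMeasurePreserving_restrict_add_toVec (A : PModule d) (x : Orthant d) :
    Measure.QuasiMeasurePreserving (fun y => y + x.toVec) (volume.restrict A.carrier)
      (volume.restrict A.carrier) :=
  (measurePreserving_add_right volume x.toVec).quasiMeasurePreserving.restrict
    fun y hy => A.add_mem y hy x

variable [InnerProductSpace ℂ k]

theorem SupportedIn.inner_eq_zero (hf : SupportedIn A B f) (hg : SupportedIn A C g)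
    (h : Disjoint B C) : ⟪f, g⟫_ℂ = 0 := by
  rw [L2.inner_def]
  refine integral_eq_zero_of_ae ?_
  filter_upwards [hf, hg] with y hfy hgy
  by_cases hB : y ∈ B
  · rw [hgy (h.notMem_of_mem_left hB), inner_zero_right, Pi.zero_apply]
  · rw [hfy hB, inner_zero_left, Pi.zero_apply]

theorem dense_setOf_supportedIn_closedBall (A : PModule d) :
    Dense {f : A.L2 k | ∃ r : ℝ, SupportedIn A (Metric.closedBall 0 r) f} := by
  refine Metric.dense_iff.2 fun f ε hε => ?_
  obtain ⟨g, hcompact, hfg, -, hg⟩ := (Lp.memLp f).exists_hasCompactSupport_eLpNorm_sub_le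
    ENNReal.ofNat_ne_top (ε := ENNReal.ofReal (ε / 2)) (by simpa using hε)
  refine ⟨hg.toLp, ?_, ?_⟩
  · rw [Metric.mem_ball', ← Lp.toLp_coeFn f (Lp.memLp f), Lp.dist_edist, Lp.edist_toLp_toLp]
    exact (ENNReal.toReal_le_of_le_ofReal (half_pos hε).le hfg).trans_lt (half_lt_self hε)
  · obtain ⟨r, hr⟩ := hcompact.isCompact.isBounded.subset_closedBall 0
    refine ⟨r, ?_⟩
    filter_upwards [hg.coeFn_toLp] with y hy hyr
    rw [hy]
    exact image_eq_zero_of_notMem_tsupport fun h => hyr (hr h)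

variable [CompleteSpace k]

theorem coeFn_adj_shiftRep (A : PModule d) (x : Orthant d) (f : A.L2 k) :
    (shiftRep k A).adj x f =ᵐ[volume.restrict A.carrier] fun y => f (y + x.toVec) := by
  rw [show (shiftRep k A).adj x f = restrictL2 A (translate (-x.toVec) (extendZero A f)) from
    adjoint_shift A x f]
  have htranslate : translate (-x.toVec) (extendZero A f) =ᵐ[volume]
      fun y => A.carrier.indicator f (y + x.toVec) := by
    refine (Lp.coeFn_compMeasurePreserving _ (measurePreserving_sub_vec (-x.toVec))).trans ?_
    simpa only [Function.comp_def, sub_neg_eq_add] using (measurePreserving_sub_vec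
      (-x.toVec)).quasiMeasurePreserving.ae_eq_comp (coeFn_extendZero A f)
  filter_upwards [coeFn_restrictL2 A (translate (-x.toVec) (extendZero A f)),
    ae_restrict_of_ae htranslate, ae_restrict_mem A.measurableSet] with y hy hy' hA
  rw [hy, hy', Set.indicator_of_mem (A.add_mem y hA x)]

theorem SupportedIn.adj (hf : SupportedIn A B f) (x : Orthant d) :
    SupportedIn A {y | y + x.toVec ∈ B} ((shiftRep k A).adj x f) := by
  filter_upwards [coeFn_adj_shiftRep A x f,
    (quasiMeasurePreserving_restrict_add_toVec A x).ae hf] with y hy hy' hB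
  rw [hy, hy' hB]

theorem SupportedIn.shift (hf : SupportedIn A B f) (x : Orthant d) :
    SupportedIn A {y | y - x.toVec ∈ B} ((shiftRep k A).toFun x f) := by
  have hf' : ∀ᵐ y ∂volume, y ∈ A.carrier → y ∉ B → f y = 0 :=
    (ae_restrict_iff' A.measurableSet).1 hf
  filter_upwards [coeFn_shift A x f, ae_restrict_of_ae
    ((measurePreserving_sub_vec x.toVec).quasiMeasurePreserving.ae hf')] with y hy hy' hB
  refine hy.trans ?_
  rw [shiftFun_eq, Set.indicator_apply_eq_zero]
  exact fun hA => hy' hA hB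

theorem tendsto_inner_shiftRep {ι : Type*} {l : Filter ι} {x : ι → Orthant d}
    (hx : Tendsto (fun n => (x n).toVec) l (Bornology.cobounded _)) (f g : A.L2 k) :
    Tendsto (fun n => ⟪(shiftRep k A).toFun (x n) f, g⟫_ℂ) l (𝓝 0) := by
  have htotal : IsTotal (Subtype.val :
      {f : A.L2 k | ∃ r : ℝ, SupportedIn A (Metric.closedBall 0 r) f} → A.L2 k) := fun f =>
    closure_mono (by simpa only [Subtype.range_coe] using Submodule.subset_span)
      (dense_setOf_supportedIn_closedBall A f)
  have hweak := htotal.tendsto_inner (l := l) (S := fun n => (shiftRep k A).adj (x n)) (S₀ := 0)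
    (.of_forall fun n => (shiftRep k A).norm_adj_le (x n)) ?_ f g
  · simpa only [(shiftRep k A).inner_adj_right, zero_apply, inner_zero_right] using hweak
  rintro ⟨f, r, hf⟩ ⟨g, s, hg⟩
  refine tendsto_const_nhds.congr' ?_
  filter_upwards [(tendsto_norm_atTop_iff_cobounded.2 hx).eventually_gt_atTop (s + r)] with n hn
  rw [zero_apply, inner_zero_right]
  refine (hf.inner_eq_zero (hg.adj (x n)) (Set.disjoint_left.2 fun y hy hy' => ?_)).symm
  have htriangle := norm_sub_le (y + (x n).toVec) y
  rw [add_sub_cancel_left] at htriangle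
  rw [mem_closedBall_zero_iff] at hy
  linarith [mem_closedBall_zero_iff.1 hy']

theorem Orthant.toVec_single (i : Fin d) (t : ℝ≥0) :
    Orthant.toVec (Pi.single i t) = Pi.single i (t : ℝ) :=
  funext fun j => Pi.apply_single (fun _ => NNReal.toReal) (fun _ => NNReal.coe_zero) i t j

theorem tendsto_toVec_single_cobounded (i : Fin d) :
    Tendsto (fun n : ℕ => Orthant.toVec (Pi.single i (n : ℝ≥0))) atTop
      (Bornology.cobounded _) := by
  rw [← tendsto_norm_atTop_iff_cobounded]
  simpa only [Orthant.toVec_single, NNReal.coe_natCast, Pi.norm_single, Real.norm_natCast] using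
    tendsto_natCast_atTop_atTop

theorem adj_shiftRep_eq_zero {j : Fin d} {m r : ℝ} {y : Orthant d}
    (hA : ∀ a ∈ A.carrier, m ≤ a j) (hf : SupportedIn A {a | a j ≤ r} f) (hy : r < m + y j) :
    (shiftRep k A).adj y f = 0 := by
  refine (hf.adj y).eq_zero (Set.disjoint_left.2 fun a ha har => ?_)
  have hle : a j + y j ≤ r := har
  linarith [hA a ha]

theorem hasTrivialFockCocycles_shiftRep {i j : Fin d} (hij : i ≠ j)
    (hA : BddBelow (Function.eval j '' A.carrier)) : HasTrivialFockCocycles (shiftRep k A) := by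
  obtain ⟨m, hm⟩ := hA
  refine hasTrivialFockCocycles_of_dense (tendsto_inner_shiftRep (tendsto_toVec_single_cobounded i))
    ((dense_setOf_supportedIn_closedBall A).mono ?_)
  rintro f ⟨r, hf⟩
  obtain ⟨t, ht⟩ := exists_nat_gt (r - m)
  refine ⟨Pi.single j (t : ℝ≥0), fun x n => adj_shiftRep_eq_zero (r := r)
    (fun a ha => hm (Set.mem_image_of_mem _ ha)) ?_ ?_⟩
  · refine ((hf.adj x).shift _).mono fun a ha => ?_
    have hnorm : ‖a - Orthant.toVec (Pi.single i (n : ℝ≥0)) + x.toVec‖ ≤ r :=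
      mem_closedBall_zero_iff.1 ha
    have hj := (Real.le_norm_self _).trans ((norm_le_pi_norm _ j).trans hnorm)
    simp only [Pi.add_apply, Pi.sub_apply, Orthant.toVec_single, Pi.single_eq_of_ne hij.symm,
      sub_zero] at hj
    exact (le_add_of_nonneg_right (x j).2).trans hj
  · rw [Pi.single_eq_same, NNReal.coe_natCast]
    linarith

theorem bddBelow_eval_prodModule {R : Fin d → Set ℝ} (hR : ∀ i, R i = Set.univ ∨ R i = Set.Ici 0)
    {j : Fin d} (hj : R j = Set.Ici 0) :
    BddBelow (Function.eval j '' (prodModule R hR).carrier) := by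
  refine ⟨0, ?_⟩
  rintro _ ⟨y, hy, rfl⟩
  exact hj.subset (hy j (Set.mem_univ j))

theorem bddBelow_eval_tModule {a b : ℝ} (ha : a < 0) (hb : 0 < b) :
    BddBelow (Function.eval 1 '' (tModule a b ha hb).carrier) := by
  refine ⟨0, ?_⟩
  rintro _ ⟨y, hy | hy, rfl⟩
  exacts [hb.le.trans hy.2, hy.2.1]

end Shift

end CCR

end

theorem mainTheorem7_general {k : Type*} [NormedAddCommGroup k] [InnerProductSpace ℂ k]
    [CompleteSpace k] {d : ℕ} (hd : 2 ≤ d) (A : CCR.PModule d) (j : Fin d)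
    (hA : BddBelow (Function.eval j '' A.carrier)) :
    {h | CCR.IsAdditiveCocycle (CCR.shiftRep k A) h} = {0} ∧
    CCR.unitSet (CCR.ccrFlow (CCR.shiftRep k A)) =
      {u | ∃ μ : Fin d → ℂ, u = fun x => Complex.exp (∑ i, (x i : ℂ) * μ i) •
        (CCR.secondQuant ((CCR.shiftRep k A).toFun x)).toContinuousLinearMap} ∧
    CCR.IsTypeII0 (CCR.ccrFlow (CCR.shiftRep k A)) := by
  have : Nontrivial (Fin d) := Fin.nontrivial_iff_two_le.2 hd
  obtain ⟨i, hij⟩ := exists_ne j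
  have htrivial : CCR.HasTrivialFockCocycles (CCR.shiftRep k A) :=
    CCR.hasTrivialFockCocycles_shiftRep hij hA
  exact ⟨htrivial.setOf_isAdditiveCocycle_eq, htrivial.unitSet_ccrFlow_eq,
    htrivial.isTypeII0_ccrFlow⟩

theorem mainTheorem7 {k : Type*} [NormedAddCommGroup k] [InnerProductSpace ℂ k] [CompleteSpace k]
    [TopologicalSpace.SeparableSpace k] :
    (∀ (d : ℕ), 2 ≤ d → ∀ (R : Fin d → Set ℝ) (hR : ∀ i, R i = Set.univ ∨ R i = Set.Ici 0),
      (∃ i, R i = Set.Ici 0) →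
        {h | CCR.IsAdditiveCocycle (CCR.shiftRep k (CCR.prodModule R hR)) h} = {0} ∧
        CCR.unitSet (CCR.ccrFlow (CCR.shiftRep k (CCR.prodModule R hR))) =
          {u | ∃ μ : Fin d → ℂ, u = fun x => Complex.exp (∑ i, (x i : ℂ) * μ i) •
            (CCR.secondQuant ((CCR.shiftRep k (CCR.prodModule R hR)).toFun x)).toContinuousLinearMap} ∧
        CCR.IsTypeII0 (CCR.ccrFlow (CCR.shiftRep k (CCR.prodModule R hR)))) ∧
    (∀ (a b : ℝ) (ha : a < 0) (hb : 0 < b),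
        {h | CCR.IsAdditiveCocycle (CCR.shiftRep k (CCR.tModule a b ha hb)) h} = {0} ∧
        CCR.unitSet (CCR.ccrFlow (CCR.shiftRep k (CCR.tModule a b ha hb))) =
          {u | ∃ μ : Fin 2 → ℂ, u = fun x => Complex.exp (∑ i, (x i : ℂ) * μ i) •
            (CCR.secondQuant ((CCR.shiftRep k (CCR.tModule a b ha hb)).toFun x)).toContinuousLinearMap} ∧
        CCR.IsTypeII0 (CCR.ccrFlow (CCR.shiftRep k (CCR.tModule a b ha hb)))) :=
  ⟨fun _ hd _ hR ⟨j, hj⟩ => mainTheorem7_general hd _ j (CCR.bddBelow_eval_prodModule hR hj),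
    fun _ _ ha hb => mainTheorem7_general le_rfl _ 1 (CCR.bddBelow_eval_tModule ha hb)⟩
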